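/- Let $(\mathcal Q,d)$ be a Hadamard space, i.e. a complete metric space such that for all $y_0,y_1\in\mathcal Q$ there is $p\in\mathcal Q$ with $d(q,p)^2\le\frac12 d(y_0,q)^2+\frac12 d(y_1,q)^2-\frac14 d(y_0,y_1)^2$ for all $q\in\mathcal Q$, equipped with its Borel $\sigma$-algebra. Let $\tau\colon[0,\infty)\to\mathbb R$ be nondecreasing and convex with $\tau(0)=0$, differentiable on $(0,\infty)$ with concave derivative $\tau'$, and $\tau'(x)>0$ for all $x>0$. Put $\tau'(0):=\lim_{x\searrow0}\tau'(x)$, and let $\tau''(x)\in[0,\infty]$ denote the right derivative of $\tau'$ at $x\ge0$ (which is finite for $x>0$). Let $n\ge1$ and let $Y,Y_1,\dots,Y_n,Y_1',\dots,Y_n'$ be independent and identically distributed $\mathcal Q$-valued random variables, where $Y$ takes values almost surely in a separable subset of $\mathcal Q$. Let $o\in\mathcal Q$ and assume $\mathbb E[\tau'(d(Y,o))]<\infty$. Let $$m\in\operatorname*{arg\,min}_{q\in\mathcal Q}\mathbb E[\tau(d(Y,q))-\tau(d(Y,o))].$$ Let $m_n$ be a $\mathcal Q$-valued random variable with $$m_n\in\operatorname*{arg\,min}_{q\in\mathcal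 Q}\sum_{j=1}^n\tau(d(Y_j,q))$$ almost surely and, for $i\in\{1,\dots,n\}$, let $m_n^i$ be a $\mathcal Q$-valued random variable that almost surely minimizes the same objective with $Y_i$ replaced by $Y_i'$. With the conventions $0^{-1}=\infty$, $\infty^{-1}=0$ and $0\cdot\infty=0$, $$\mathbb E\big[d(m,m_n)^2\,\tau''\big(d(Y,m)+d(m,m_n)\big)\big]\le\frac{32}{n^2}\sum_{i=1}^n\mathbb E\big[\tau'(d(Y_i,m))^2\,H_i^{-1}\big],\qquad H_i:=\frac1n\sum_{j=1}^n\tau''\big(d(Y_j,m_n)+d(m_n,m_n^i)\big),$$ where both sides may be infinite. In particular, if $\tau(x)=x^2$ for all $x\ge0$, then $\mathbb E[d(m,m_n)^2]\le\frac{32}{n}\,\mathbb E[d(Y,m)^2]$. -/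

import Mathlib

open MeasureTheory ProbabilityTheory Set Filter Topology
open scoped ENNReal

noncomputable section

/-- A Hadamard space: a complete metric space in which any two points `y₀, y₁` have a point `m`
(their midpoint) satisfying the nonpositive-curvature inequality against every `q`. -/
structure IsHadamard (Q : Type*) [MetricSpace Q] : Prop where
  complete : CompleteSpace Q
  npc : ∀ y₀ y₁ : Q, ∃ m : Q, ∀ q : Q,
    dist q m ^ 2 ≤ 1 / 2 * dist y₀ q ^ 2 + 1 / 2 * dist y₁ q ^ 2 - 1 / 4 * dist y₀ y₁ ^ 2

/-- Nondecreasing convex functions `[0, ∞) → ℝ` that are differentiable on `(0, ∞)` with concave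
derivative. Such a function is represented by a function on `ℝ`, whose values at negative
arguments play no role. -/
structure IsConvexConcaveDeriv (τ : ℝ → ℝ) : Prop where
  mono : MonotoneOn τ (Ici 0)
  convex : ConvexOn ℝ (Ici 0) τ
  diff : ∀ x, 0 < x → DifferentiableAt ℝ τ x
  concave_deriv : ConcaveOn ℝ (Ioi 0) (deriv τ)

/-- The admissible transformations: as above, with `τ 0 = 0` and positive derivative on
`(0, ∞)`. -/
structure IsTransformation (τ : ℝ → ℝ) : Prop extends IsConvexConcaveDeriv τ where
  zero : τ 0 = 0
  deriv_pos : ∀ x, 0 < x → 0 < deriv τ x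

/-- The derivative `τ'` on `[0, ∞)`, where `τ' 0` is the limit of `τ' x` as `x ↘ 0`. -/
def transDeriv (τ : ℝ → ℝ) (x : ℝ) : ℝ :=
  if x = 0 then limUnder (𝓝[>] (0 : ℝ)) (deriv τ) else deriv τ x

/-- The right derivative of `τ'` at `x ≥ 0`, as an element of `[0, ∞]`. As `τ'` is nondecreasing,
the difference quotients are nonnegative; as `τ'` is concave, their limit exists in `[0, ∞]` for
all `x ≥ 0` and is finite for `x > 0`. -/
def transRightDeriv2 (τ : ℝ → ℝ) (x : ℝ) : ℝ≥0∞ :=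
  limUnder (𝓝[>] x) fun y => ENNReal.ofReal ((transDeriv τ y - transDeriv τ x) / (y - x))

/-- `m` minimizes `q ↦ 𝔼[τ(d(Y, q)) - τ(d(Y, o))]`. -/
def IsFrechetMean {Ω Q : Type*} [MeasurableSpace Ω] [MetricSpace Q] (P : Measure Ω)
    (τ : ℝ → ℝ) (Y : Ω → Q) (o m : Q) : Prop :=
  IsMinOn (fun q : Q => ∫ ω, (τ (dist (Y ω) q) - τ (dist (Y ω) o)) ∂P) univ m

/-- `m` minimizes `q ↦ ∑ j, τ(d(y j, q))`. -/
def IsSampleFrechetMean {Q : Type*} [MetricSpace Q] {n : ℕ} (τ : ℝ → ℝ) (y : Fin n → Q)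
    (m : Q) : Prop :=
  IsMinOn (fun q : Q => ∑ j, τ (dist (y j) q)) univ m

/-- The quantity `H_i = (1/n) ∑ j, τ''(d(y_j, a) + d(a, b))` for a sample `y` and points `a`, `b`
(the estimators from the original sample and from the modified one). -/
def stabilityH {Q : Type*} [MetricSpace Q] {n : ℕ} (τ : ℝ → ℝ) (y : Fin n → Q) (a b : Q) :
    ℝ≥0∞ :=
  (n : ℝ≥0∞)⁻¹ * ∑ j, transRightDeriv2 τ (dist (y j) a + dist a b)

end

/-! The excess risk of the sample mean is bounded below by curvature and above by stability. Let
F(q) = 𝔼[τ(d(Y,q)) − τ(d(Y,m))]. With κ = τ''(L), the function τ(r) − (κ/2)r² is still nondecreasing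
and convex on [0, L], because τ'' is nonincreasing. Its composition with a distance is convex along
geodesics, and the squared distance is strongly convex there by nonpositive curvature. So
transformed distances are strongly convex (`IsTransformation.strongConvexity`), and minimality of m
gives d(m,q)² 𝔼[τ''(d(Y,m) + d(m,q))] ≤ 2F(q). Sample means satisfy the analogous inequality.

For the upper bound, m_n does at least as well as m on the sample, so F(m_n) is at most the average
over i of the expected excess loss at a fresh observation minus the excess loss at Y_i. Swapping Y_i
and Y_i' preserves the law. Symmetrizing over the swap leaves half the expectation of a quadruple
expression in Y_i, Y_i', a = m_n, b = m_n^i. The quadruple inequality (`IsTransformation.quadruple`)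
bounds that expression by 2d(a,b)T, where T = τ'(d(Y_i,m)) + τ'(d(Y_i',m)). The variance
inequalities at a and b bound the same expression below by n(H+H')d(a,b)²/2 (`stability_le`). Hence
d(a,b) ≤ 4T/(n(H+H')), and d(a,b)T is at most (8/n)(τ'(d(Y_i,m))²/H + τ'(d(Y_i',m))²/H'). The swap
exchanges the two summands, which gives 16/n; the factor 2 of the variance inequality makes it 32.

Two difficulties remain. First, F(m_n) need not be integrable, so it is weighted by K/(K + d(m_n,m))
and K → ∞. The weight is not invariant under the swap, but the resulting error is controlled by the
integrable cost d(a,b)T. Second, the argument needs m_n to be a function of the sample alone,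
although minimizers may fail to be unique. If τ'' vanishes at all d(Y_j,m_n) with positive
probability, the right-hand side is infinite. Otherwise the minimizer is almost surely unique and is
a limit of measurable almost minimizers (`exists_stronglyMeasurable_sampleFrechetMean`). -/

namespace IsTransformation

/-! ### The derivative τ' on [0, ∞) and increments of τ. -/

variable {τ : ℝ → ℝ}

theorem monotoneOn_deriv (h : IsTransformation τ) : MonotoneOn (deriv τ) (Ioi 0) :=
  (h.convex.subset Ioi_subset_Ici_self (convex_Ioi 0)).monotoneOn_deriv fun x hx => h.diff x hx

theorem transDeriv_of_pos {x : ℝ} (hx : 0 < x) : transDeriv τ x = deriv τ x := by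
  simp [transDeriv, hx.ne']

theorem tendsto_transDeriv_zero (h : IsTransformation τ) :
    Tendsto (transDeriv τ) (𝓝[>] 0) (𝓝 (transDeriv τ 0)) := by
  have hb : BddBelow (deriv τ '' Ioi 0) :=
    ⟨0, by rintro _ ⟨x, hx, rfl⟩; exact (h.deriv_pos x hx).le⟩
  have ht := h.monotoneOn_deriv.tendsto_nhdsGT hb
  have h0 : transDeriv τ 0 = sInf (deriv τ '' Ioi 0) := by
    simp only [transDeriv, if_true]
    exact ht.limUnder_eq
  rw [h0]
  refine ht.congr' ?_
  filter_upwards [self_mem_nhdsWithin] with x hx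
  exact (transDeriv_of_pos hx).symm

theorem continuousAt_transDeriv (h : IsTransformation τ) {x : ℝ} (hx : 0 < x) :
    ContinuousAt (transDeriv τ) x := by
  have hc : ContinuousOn (deriv τ) (Ioi 0) := by
    have := h.concave_deriv.continuousOn_interior
    rwa [interior_Ioi] at this
  refine (hc.continuousAt (Ioi_mem_nhds hx)).congr ?_
  filter_upwards [Ioi_mem_nhds hx] with y hy
  exact (transDeriv_of_pos hy).symm

/-- Lets inequalities for τ' pass from (0, ∞) to [0, ∞): shift all arguments by ε > 0 and let ε → 0.
-/
theorem tendsto_transDeriv_add (h : IsTransformation τ) {x : ℝ} (hx : 0 ≤ x) :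
    Tendsto (fun ε => transDeriv τ (x + ε)) (𝓝[>] 0) (𝓝 (transDeriv τ x)) := by
  rcases hx.eq_or_lt with rfl | hx
  · simpa using h.tendsto_transDeriv_zero
  · have : Tendsto (fun ε : ℝ => x + ε) (𝓝[>] 0) (𝓝 x) := by
      have : Tendsto (fun ε : ℝ => x + ε) (𝓝 0) (𝓝 (x + 0)) :=
        (by fun_prop : Continuous fun ε : ℝ => x + ε).tendsto 0
      rw [add_zero] at this
      exact this.mono_left nhdsWithin_le_nhds
    exact (h.continuousAt_transDeriv hx).tendsto.comp this

theorem concaveOn_transDeriv (h : IsTransformation τ) :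
    ConcaveOn ℝ (Ici 0) (transDeriv τ) := by
  refine ⟨convex_Ici 0, fun x hx y hy a b ha hb hab => ?_⟩
  have hx : 0 ≤ x := hx
  have hy : 0 ≤ y := hy
  have hz : 0 ≤ a * x + b * y := by positivity
  simp only [smul_eq_mul]
  refine le_of_tendsto_of_tendsto
    (((h.tendsto_transDeriv_add hx).const_mul a).add ((h.tendsto_transDeriv_add hy).const_mul b))
    (h.tendsto_transDeriv_add hz) ?_
  filter_upwards [self_mem_nhdsWithin] with ε hε
  have hε : 0 < ε := hε
  have := h.concave_deriv.2 (show x + ε ∈ Ioi 0 by simp; linarith)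
    (show y + ε ∈ Ioi 0 by simp; linarith) ha hb hab
  rw [transDeriv_of_pos (by linarith), transDeriv_of_pos (by linarith),
    transDeriv_of_pos (by linarith)]
  simp only [smul_eq_mul] at this
  convert this using 2
  linear_combination (-ε) * hab

theorem monotoneOn_transDeriv (h : IsTransformation τ) :
    MonotoneOn (transDeriv τ) (Ici 0) := by
  intro x hx y hy hxy
  refine le_of_tendsto_of_tendsto (h.tendsto_transDeriv_add hx) (h.tendsto_transDeriv_add hy) ?_
  filter_upwards [self_mem_nhdsWithin] with ε hε
  have hε : 0 < ε := hε
  have hx : 0 ≤ x := hx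
  rw [transDeriv_of_pos (by linarith), transDeriv_of_pos (by linarith)]
  exact h.monotoneOn_deriv (by simp; linarith) (by simp; linarith) (by linarith)

theorem transDeriv_mono (h : IsTransformation τ) {x y : ℝ} (hx : 0 ≤ x) (hxy : x ≤ y) :
    transDeriv τ x ≤ transDeriv τ y :=
  h.monotoneOn_transDeriv hx (hx.trans hxy) hxy

theorem transDeriv_nonneg (h : IsTransformation τ) {x : ℝ} (hx : 0 ≤ x) :
    0 ≤ transDeriv τ x := by
  refine ge_of_tendsto (h.tendsto_transDeriv_add hx) ?_
  filter_upwards [self_mem_nhdsWithin] with ε hε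
  have hε : 0 < ε := hε
  rw [transDeriv_of_pos (by linarith)]
  exact (h.deriv_pos _ (by linarith)).le

theorem transDeriv_pos (h : IsTransformation τ) {x : ℝ} (hx : 0 < x) : 0 < transDeriv τ x := by
  rw [transDeriv_of_pos hx]
  exact h.deriv_pos x hx

/-- Concavity between 0 and x, with τ' 0 ≥ 0 dropped. Subadditivity and at most linear growth of τ'
both follow from this. -/
theorem mul_transDeriv_le (h : IsTransformation τ) {c x : ℝ} (hc : 0 ≤ c) (hc1 : c ≤ 1)
    (hx : 0 ≤ x) : c * transDeriv τ x ≤ transDeriv τ (c * x) := by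
  have := h.concaveOn_transDeriv.2 (show x ∈ Ici 0 from hx) (show (0 : ℝ) ∈ Ici 0 by simp) hc
    (sub_nonneg.2 hc1) (by ring)
  simp only [smul_eq_mul, mul_zero, add_zero] at this
  have h0 := mul_nonneg (sub_nonneg.2 hc1) (h.transDeriv_nonneg le_rfl)
  linarith

theorem transDeriv_mul_le (h : IsTransformation τ) {c x : ℝ} (hc : 1 ≤ c) (hx : 0 ≤ x) :
    transDeriv τ (c * x) ≤ c * transDeriv τ x := by
  have hc0 : 0 < c := by linarith
  have := h.mul_transDeriv_le (c := c⁻¹) (x := c * x) (by positivity) (inv_le_one_of_one_le₀ hc)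
    (by positivity)
  rw [inv_mul_cancel_left₀ hc0.ne', inv_mul_le_iff₀ hc0] at this
  exact this

theorem transDeriv_add_le (h : IsTransformation τ) {a b : ℝ} (ha : 0 ≤ a) (hb : 0 ≤ b) :
    transDeriv τ (a + b) ≤ transDeriv τ a + transDeriv τ b := by
  rcases (add_nonneg ha hb).eq_or_lt with h0 | h0
  · obtain rfl : a = 0 := by linarith
    obtain rfl : b = 0 := by linarith
    have := h.transDeriv_nonneg (le_refl (0 : ℝ))
    simpa using this
  · have h1 := h.mul_transDeriv_le (c := a / (a + b)) (by positivity)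
      ((div_le_one h0).2 (by linarith)) h0.le
    have h2 := h.mul_transDeriv_le (c := b / (a + b)) (by positivity)
      ((div_le_one h0).2 (by linarith)) h0.le
    rw [div_mul_cancel₀ _ h0.ne'] at h1 h2
    have h3 : transDeriv τ (a + b) = a / (a + b) * transDeriv τ (a + b)
      + b / (a + b) * transDeriv τ (a + b) := by
      field_simp
    linarith

/-- Comparison of `s * τ' p` and `u * τ' v` for a rectangle `s × p` of controlled area. -/
theorem mul_transDeriv_le_of_mul_le (h : IsTransformation τ) {k s u p v : ℝ} (hk : 1 ≤ k)
    (hs : 0 ≤ s) (hsu : s ≤ u) (hp : 0 ≤ p) (hv : 0 ≤ v) (hspuv : s * p ≤ k * u * v) :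
    s * transDeriv τ p ≤ k * u * transDeriv τ v := by
  have hv' := h.transDeriv_nonneg hv
  rcases hs.eq_or_lt with rfl | hs
  · rw [zero_mul]; positivity
  · have h1 : 1 ≤ k * u / s := by rw [le_div_iff₀ hs]; nlinarith
    have h2 : p ≤ k * u / s * v := by
      rw [div_mul_eq_mul_div, le_div_iff₀ hs]; linarith
    calc s * transDeriv τ p ≤ s * (k * u / s * transDeriv τ v) := by
          gcongr
          exact (h.transDeriv_mono hp h2).trans (h.transDeriv_mul_le h1 hv)
      _ = k * u * transDeriv τ v := by field_simp

theorem continuousOn (h : IsTransformation τ) : ContinuousOn τ (Ici 0) := by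
  intro x hx
  rcases (show (0 : ℝ) ≤ x from hx).eq_or_lt with rfl | hx
  -- At 0, where differentiability is not assumed, monotonicity and convexity squeeze τ between 0
  -- and its chord over [0, 1].
  · have h1 : Tendsto (fun x : ℝ => x * τ 1) (𝓝[Ici 0] 0) (𝓝 0) := by
      have : Tendsto (fun x : ℝ => x * τ 1) (𝓝 0) (𝓝 (0 * τ 1)) :=
        (by fun_prop : Continuous fun x : ℝ => x * τ 1).tendsto 0
      rw [zero_mul] at this
      exact this.mono_left nhdsWithin_le_nhds
    rw [ContinuousWithinAt, h.zero]
    refine tendsto_of_tendsto_of_tendsto_of_le_of_le' tendsto_const_nhds h1 ?_ ?_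
    · filter_upwards [self_mem_nhdsWithin] with x hx
      rw [← h.zero]
      exact h.mono (by simp) hx hx
    · filter_upwards [self_mem_nhdsWithin, nhdsWithin_le_nhds (Iic_mem_nhds one_pos)] with x hx hx1
      have := h.convex.2 (show (1 : ℝ) ∈ Ici 0 by simp) (show (0 : ℝ) ∈ Ici 0 by simp)
        (show (0 : ℝ) ≤ x from hx) (sub_nonneg.2 hx1) (by ring)
      simpa [h.zero] using this
  · exact (h.diff x hx).continuousAt.continuousWithinAt

theorem exists_sub_eq (h : IsTransformation τ) {a b : ℝ} (hb : 0 ≤ b) (hba : b < a) :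
    ∃ c ∈ Ioo b a, τ a - τ b = (a - b) * transDeriv τ c := by
  obtain ⟨c, hc, hc'⟩ := exists_deriv_eq_slope τ hba
    (h.continuousOn.mono fun x hx => hb.trans hx.1)
    (fun x hx => (h.diff x (hb.trans_lt hx.1)).differentiableWithinAt)
  refine ⟨c, hc, ?_⟩
  rw [transDeriv_of_pos (hb.trans_lt hc.1), hc', mul_div_cancel₀ _ (sub_pos.2 hba).ne']

theorem mul_transDeriv_le_sub (h : IsTransformation τ) {a b : ℝ} (hb : 0 ≤ b) (hba : b ≤ a) :
    (a - b) * transDeriv τ b ≤ τ a - τ b := by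
  rcases hba.eq_or_lt with rfl | hba
  · simp
  · obtain ⟨c, hc, hc'⟩ := h.exists_sub_eq hb hba
    rw [hc']
    exact mul_le_mul_of_nonneg_left (h.transDeriv_mono hb hc.1.le) (by linarith)

theorem abs_sub_le (h : IsTransformation τ) {a b M : ℝ} (ha : 0 ≤ a) (hb : 0 ≤ b)
    (haM : a ≤ M) (hbM : b ≤ M) : |τ a - τ b| ≤ |a - b| * transDeriv τ M := by
  wlog hba : b ≤ a generalizing a b
  · rw [abs_sub_comm, abs_sub_comm a]
    exact this hb ha hbM haM (by linarith)
  rcases hba.eq_or_lt with rfl | hba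
  · simp
  · obtain ⟨c, hc, hc'⟩ := h.exists_sub_eq hb hba
    rw [hc', abs_mul, abs_of_nonneg (h.transDeriv_nonneg (hb.trans hc.1.le))]
    exact mul_le_mul_of_nonneg_left (h.transDeriv_mono (hb.trans hc.1.le) (hc.2.le.trans haM))
      (abs_nonneg _)

/-- The Hermite-Hadamard inequality for the concave derivative. -/
theorem sub_le_mul_transDeriv_midpoint (h : IsTransformation τ) {a b : ℝ} (hb : 0 ≤ b)
    (hba : b ≤ a) : τ a - τ b ≤ (a - b) * transDeriv τ ((a + b) / 2) := by
  set c := (a + b) / 2 with hc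
  set r := (a - b) / 2 with hr
  have hr0 : 0 ≤ r := by rw [hr]; linarith
  have hcr : r ≤ c := by rw [hr, hc]; linarith
  -- The derivative in s is τ'(c+s) + τ'(c−s) − 2τ'(c), which is nonpositive by concavity of τ'.
  have hanti : AntitoneOn (fun s => τ (c + s) - τ (c - s) - 2 * s * transDeriv τ c) (Icc 0 r) := by
    refine antitoneOn_of_hasDerivWithinAt_nonpos (convex_Icc 0 r)
      (f' := fun s => deriv τ (c + s) * 1 - deriv τ (c - s) * (0 - 1) - 2 * 1 * transDeriv τ c) ?_ ?_ ?_
    · have h1 : ContinuousOn (fun s => τ (c + s)) (Icc 0 r) :=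
        h.continuousOn.comp (by fun_prop) fun s hs => by
          simp only [mem_Ici, mem_Icc] at *; linarith [hs.1]
      have h2 : ContinuousOn (fun s => τ (c - s)) (Icc 0 r) :=
        h.continuousOn.comp (by fun_prop) fun s hs => by
          simp only [mem_Ici, mem_Icc] at *; linarith [hs.2]
      exact (h1.sub h2).sub (by fun_prop)
    · intro s hs
      rw [interior_Icc] at hs
      have h1 : HasDerivAt (fun s => τ (c + s)) (deriv τ (c + s) * 1) s :=
        (h.diff (c + s) (by linarith [hs.1])).hasDerivAt.comp s ((hasDerivAt_id s).const_add c)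
      have h2 : HasDerivAt (fun s => τ (c - s)) (deriv τ (c - s) * (0 - 1)) s :=
        (h.diff (c - s) (by linarith [hs.2])).hasDerivAt.comp s
          ((hasDerivAt_const s c).sub (hasDerivAt_id s))
      exact ((h1.sub h2).sub (((hasDerivAt_id s).const_mul 2).mul_const _)).hasDerivWithinAt
    · intro s hs
      rw [interior_Icc] at hs
      have h1 : 0 < c + s := by linarith [hs.1]
      have h2 : 0 < c - s := by linarith [hs.2]
      rw [← transDeriv_of_pos h1, ← transDeriv_of_pos h2]
      have := h.concaveOn_transDeriv.2 (show c + s ∈ Ici 0 from h1.le)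
        (show c - s ∈ Ici 0 from h2.le) (show (0 : ℝ) ≤ 1 / 2 by norm_num)
        (show (0 : ℝ) ≤ 1 / 2 by norm_num) (by norm_num)
      simp only [smul_eq_mul] at this
      rw [show 1 / 2 * (c + s) + 1 / 2 * (c - s) = c by ring] at this
      linarith
  have := hanti (left_mem_Icc.2 hr0) (right_mem_Icc.2 hr0) hr0
  simp only [add_zero, sub_zero, sub_self, mul_zero, zero_mul] at this
  rw [show c + r = a by rw [hc, hr]; ring, show c - r = b by rw [hc, hr]; ring,
    show 2 * r = a - b by rw [hr]; ring] at this
  linarith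

theorem pos (h : IsTransformation τ) {x : ℝ} (hx : 0 < x) : 0 < τ x := by
  obtain ⟨c, hc, hc'⟩ := h.exists_sub_eq le_rfl hx
  rw [h.zero] at hc'
  have := mul_pos hx (h.transDeriv_pos hc.1)
  linarith

theorem nonneg (h : IsTransformation τ) {x : ℝ} (hx : 0 ≤ x) : 0 ≤ τ x := by
  rw [← h.zero]; exact h.mono (by simp) hx hx

/-! ### The right derivative of τ' and its comparison with slopes. -/

/-- The slopes of `τ'` on the right of a point decrease when the two points increase. -/
theorem slope_transDeriv_le (h : IsTransformation τ) {a b c d : ℝ} (ha : 0 ≤ a) (hab : a < b)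
    (hcd : c < d) (hac : a ≤ c) (hbd : b ≤ d) :
    (transDeriv τ d - transDeriv τ c) / (d - c) ≤ (transDeriv τ b - transDeriv τ a) / (b - a) := by
  have hc : 0 ≤ c := ha.trans hac
  have h1 : (transDeriv τ d - transDeriv τ c) / (d - c)
      ≤ (transDeriv τ d - transDeriv τ a) / (d - a) := by
    rcases hac.eq_or_lt with rfl | hac
    · exact le_rfl
    · have := h.concaveOn_transDeriv.slope_anti_adjacent (show a ∈ Ici 0 from ha)
        (show d ∈ Ici 0 from hc.trans hcd.le) hac hcd
      have h1 : 0 < c - a := by linarith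
      have h2 : 0 < d - c := by linarith
      rw [div_le_div_iff₀ h2 h1] at this
      rw [div_le_div_iff₀ h2 (by linarith)]
      nlinarith
  refine h1.trans ?_
  rcases hbd.eq_or_lt with rfl | hbd
  · exact le_rfl
  · have := h.concaveOn_transDeriv.slope_anti_adjacent (show a ∈ Ici 0 from ha)
      (show d ∈ Ici 0 from hc.trans hcd.le) hab hbd
    have h1 : 0 < b - a := by linarith
    have h2 : 0 < d - b := by linarith
    rw [div_le_div_iff₀ h2 h1] at this
    rw [div_le_div_iff₀ (by linarith) h1]
    nlinarith

/-- The slopes of a concave function from x increase as the second point decreases to x, so their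
limit exists and is their supremum. Every later fact about τ'' is read off from this form. -/
theorem transRightDeriv2_eq_iSup (h : IsTransformation τ) {x : ℝ} (hx : 0 ≤ x) :
    transRightDeriv2 τ x =
      ⨆ y ∈ Ioi x, ENNReal.ofReal ((transDeriv τ y - transDeriv τ x) / (y - x)) := by
  refine Tendsto.limUnder_eq ?_
  refine tendsto_order.2 ⟨fun c hc => ?_, fun c hc => ?_⟩
  · simp only [lt_iSup_iff] at hc
    obtain ⟨y, hy, hcy⟩ := hc
    filter_upwards [Ioc_mem_nhdsGT (show x < y from hy)] with z hz
    exact hcy.trans_le (ENNReal.ofReal_le_ofReal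
      (h.slope_transDeriv_le hx hz.1 hy le_rfl hz.2))
  · filter_upwards [self_mem_nhdsWithin] with z hz
    exact (le_iSup₂ (f := fun y (_ : y ∈ Ioi x) =>
      ENNReal.ofReal ((transDeriv τ y - transDeriv τ x) / (y - x))) z hz).trans_lt hc

theorem transRightDeriv2_le_slope (h : IsTransformation τ) {a b x : ℝ} (ha : 0 ≤ a)
    (hab : a < b) (hbx : b ≤ x) :
    transRightDeriv2 τ x ≤ ENNReal.ofReal ((transDeriv τ b - transDeriv τ a) / (b - a)) := by
  rw [h.transRightDeriv2_eq_iSup (by linarith)]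
  exact iSup₂_le fun y hy => ENNReal.ofReal_le_ofReal
    (h.slope_transDeriv_le ha hab hy (by linarith) (hbx.trans (le_of_lt hy)))

theorem slope_le_transRightDeriv2 (h : IsTransformation τ) {x y : ℝ} (hx : 0 ≤ x) (hxy : x < y) :
    ENNReal.ofReal ((transDeriv τ y - transDeriv τ x) / (y - x)) ≤ transRightDeriv2 τ x := by
  rw [h.transRightDeriv2_eq_iSup hx]
  exact le_iSup₂ (f := fun y (_ : y ∈ Ioi x) =>
      ENNReal.ofReal ((transDeriv τ y - transDeriv τ x) / (y - x))) y hxy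

theorem transRightDeriv2_lt_top (h : IsTransformation τ) {x : ℝ} (hx : 0 < x) :
    transRightDeriv2 τ x < ∞ :=
  (h.transRightDeriv2_le_slope le_rfl hx le_rfl).trans_lt ENNReal.ofReal_lt_top

/-- The value ∞ is possible only at x = 0, where a = b, so the default value of `toReal` is
harmless. -/
theorem toReal_transRightDeriv2_mul_le (h : IsTransformation τ) {a b x : ℝ} (ha : 0 ≤ a)
    (hab : a ≤ b) (hbx : b ≤ x) :
    (transRightDeriv2 τ x).toReal * (b - a) ≤ transDeriv τ b - transDeriv τ a := by
  rcases hab.eq_or_lt with rfl | hab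
  · simp
  · have h1 := ENNReal.toReal_mono ENNReal.ofReal_ne_top (h.transRightDeriv2_le_slope ha hab hbx)
    have h2 : 0 < b - a := by linarith
    rwa [ENNReal.toReal_ofReal (div_nonneg (sub_nonneg.2 (h.transDeriv_mono ha hab.le)) h2.le),
      le_div_iff₀ h2] at h1

theorem antitoneOn_transRightDeriv2 (h : IsTransformation τ) :
    AntitoneOn (transRightDeriv2 τ) (Ici 0) := by
  intro a ha b hb hab
  rw [h.transRightDeriv2_eq_iSup hb]
  refine iSup₂_le fun y hy => ?_
  have hby : b < y := hy
  exact (ENNReal.ofReal_le_ofReal (h.slope_transDeriv_le ha (by linarith) hy hab le_rfl)).trans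
    (h.slope_le_transRightDeriv2 ha (by linarith))

/-- The second derivative vanishes at `x` if it vanishes on the right of `x`. -/
theorem transRightDeriv2_eq_zero (h : IsTransformation τ) {x : ℝ} (hx : 0 ≤ x)
    (h0 : ∀ ε, 0 < ε → transRightDeriv2 τ (x + ε) = 0) : transRightDeriv2 τ x = 0 := by
  rw [h.transRightDeriv2_eq_iSup hx]
  simp only [ENNReal.iSup_eq_zero]
  intro y hy
  have hxy : x < y := hy
  rw [ENNReal.ofReal_eq_zero]
  refine div_nonpos_of_nonpos_of_nonneg ?_ (by linarith)
  rw [sub_nonpos]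
  refine ge_of_tendsto (h.tendsto_transDeriv_add hx) ?_
  filter_upwards [Ioo_mem_nhdsGT (sub_pos.2 hxy)] with ε hε
  have hlt : x + ε < y := by linarith [hε.2]
  have := h.slope_le_transRightDeriv2 (add_nonneg hx hε.1.le) hlt
  rw [h0 ε hε.1, nonpos_iff_eq_zero, ENNReal.ofReal_eq_zero] at this
  have hpos : 0 < y - (x + ε) := by linarith
  rw [div_le_iff₀ hpos, zero_mul] at this
  linarith

/-! ### Measurability of τ, τ' and τ'' along nonnegative functions. -/

section Measurability

variable {α : Type*} [MeasurableSpace α] {f : α → ℝ}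

theorem measurable_comp (h : IsTransformation τ) (hf : Measurable f) (h0 : ∀ x, 0 ≤ f x) :
    Measurable fun x => τ (f x) := by
  -- Nothing is known about τ at negative arguments; truncating at 0 gives a function monotone on
  -- all of ℝ.
  have h1 : Monotone fun x => τ (max x 0) := fun x y hxy =>
    h.mono (mem_Ici.2 (le_max_right _ _)) (mem_Ici.2 (le_max_right _ _)) (max_le_max_right 0 hxy)
  simpa [h0, Function.comp_def] using h1.measurable.comp hf

theorem measurable_transDeriv_comp (h : IsTransformation τ) (hf : Measurable f)
    (h0 : ∀ x, 0 ≤ f x) : Measurable fun x => transDeriv τ (f x) := by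
  have h1 : Monotone fun x => transDeriv τ (max x 0) := fun x y hxy =>
    h.transDeriv_mono (le_max_right _ _) (max_le_max_right 0 hxy)
  simpa [h0, Function.comp_def] using h1.measurable.comp hf

theorem measurable_transRightDeriv2_comp (h : IsTransformation τ) (hf : Measurable f)
    (h0 : ∀ x, 0 ≤ f x) : Measurable fun x => transRightDeriv2 τ (f x) := by
  have h1 : Antitone fun x => transRightDeriv2 τ (max x 0) := fun x y hxy =>
    h.antitoneOn_transRightDeriv2 (mem_Ici.2 (le_max_right _ _)) (mem_Ici.2 (le_max_right _ _))
      (max_le_max_right 0 hxy)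
  simpa [h0, Function.comp_def] using h1.measurable.comp hf

end Measurability

end IsTransformation

/-! ### Geodesics and the quadratic quadruple inequality in Hadamard spaces. -/

section Geodesic

variable {Q : Type*} [MetricSpace Q]

/-- `g` divides the pair `x`, `y` in the ratio `t : 1 - t`, with the comparison inequality of
nonpositive curvature against every point. -/
def IsGeodesicPoint (x y : Q) (t : ℝ) (g : Q) : Prop :=
  ∀ q : Q, dist q g ^ 2 ≤ (1 - t) * dist x q ^ 2 + t * dist y q ^ 2 - t * (1 - t) * dist x y ^ 2

namespace IsGeodesicPoint

variable {x y g g' : Q} {s t : ℝ}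

theorem dist_left_le (h : IsGeodesicPoint x y t g) (ht : 0 ≤ t) : dist x g ≤ t * dist x y := by
  refine abs_le_of_sq_le_sq' ?_ (by positivity) |>.2
  have := h x
  rw [dist_self, dist_comm y x] at this
  nlinarith

theorem dist_right_le (h : IsGeodesicPoint x y t g) (ht : t ≤ 1) :
    dist y g ≤ (1 - t) * dist x y := by
  refine abs_le_of_sq_le_sq' ?_ (mul_nonneg (sub_nonneg.2 ht) dist_nonneg) |>.2
  have := h y
  rw [dist_self] at this
  nlinarith

theorem dist_left (h : IsGeodesicPoint x y t g) (ht : 0 ≤ t) (ht1 : t ≤ 1) :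
    dist x g = t * dist x y := by
  have h1 := h.dist_left_le ht
  have h2 := h.dist_right_le ht1
  have h3 := dist_triangle_right x y g
  linarith

theorem dist_le (h : IsGeodesicPoint x y t g) (h' : IsGeodesicPoint x y s g') (hs : 0 ≤ s)
    (hs1 : s ≤ 1) (ht : 0 ≤ t) (ht1 : t ≤ 1) : dist g' g ≤ |t - s| * dist x y := by
  refine abs_le_of_sq_le_sq' ?_ (by positivity) |>.2
  have h1 := h g'
  have h2 : dist x g' ^ 2 ≤ (s * dist x y) ^ 2 := by gcongr; exact h'.dist_left_le hs
  have h3 : dist y g' ^ 2 ≤ ((1 - s) * dist x y) ^ 2 := by gcongr; exact h'.dist_right_le hs1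
  have h4 := mul_le_mul_of_nonneg_left h2 (sub_nonneg.2 ht1)
  have h5 := mul_le_mul_of_nonneg_left h3 ht
  rw [mul_pow, sq_abs]
  linarith

theorem le_dist (h : IsGeodesicPoint x y t g) (h' : IsGeodesicPoint x y s g') (hs : 0 ≤ s)
    (ht1 : t ≤ 1) : (t - s) * dist x y ≤ dist g' g := by
  have h1 := h'.dist_left_le hs
  have h2 := h.dist_right_le ht1
  have h3 := dist_triangle4 x g' g y
  rw [dist_comm g y] at h3
  linarith

/-- Distances to a point are convex along geodesics. -/
theorem dist_le_convex (h : IsGeodesicPoint x y t g) (ht : 0 ≤ t) (ht1 : t ≤ 1) (q : Q) :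
    dist q g ≤ (1 - t) * dist q x + t * dist q y := by
  have h1t := sub_nonneg.2 ht1
  refine abs_le_of_sq_le_sq' ?_ (by positivity) |>.2
  have h1 := h q
  rw [dist_comm x q, dist_comm y q] at h1
  have h2 : (dist q x - dist q y) ^ 2 ≤ dist x y ^ 2 :=
    sq_le_sq' (by linarith [dist_triangle q x y]) (by linarith [dist_triangle_right q x y, dist_comm x y])
  have h3 := mul_le_mul_of_nonneg_left h2 (mul_nonneg ht h1t)
  nlinarith

end IsGeodesicPoint

/-- The set of attained ratios contains 0 and 1, is closed under midpoints by the defining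
inequality, and is topologically closed by completeness. A gap around t would have attained
endpoints, whose midpoint would lie inside it. -/
theorem IsHadamard.exists_isGeodesicPoint (hQ : IsHadamard Q) (x y : Q) {t : ℝ}
    (ht : t ∈ Icc (0 : ℝ) 1) : ∃ g, IsGeodesicPoint x y t g := by
  have := hQ.complete
  set T : Set ℝ := {t | t ∈ Icc (0 : ℝ) 1 ∧ ∃ g, IsGeodesicPoint x y t g} with hT
  have h0 : (0 : ℝ) ∈ T := ⟨by simp, x, fun q => by simp [dist_comm]⟩
  have h1 : (1 : ℝ) ∈ T := ⟨by simp, y, fun q => by simp [dist_comm]⟩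
  have hmid : ∀ s ∈ T, ∀ t ∈ T, s < t → (s + t) / 2 ∈ T := by
    rintro s ⟨hs, g', hg'⟩ t ⟨ht, g, hg⟩ hst
    refine ⟨⟨by linarith [hs.1, ht.1], by linarith [hs.2, ht.2]⟩, ?_⟩
    obtain ⟨m, hm⟩ := hQ.npc g' g
    refine ⟨m, fun q => ?_⟩
    have a1 := hm q
    have a2 := hg q
    have a3 := hg' q
    have a4 := hg.le_dist hg' hs.1 ht.2
    have a5 : ((t - s) * dist x y) ^ 2 ≤ dist g' g ^ 2 :=
      pow_le_pow_left₀ (mul_nonneg (by linarith) dist_nonneg) a4 2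
    rw [dist_comm g' q, dist_comm g q] at a1
    nlinarith
  have hclosed : IsClosed T := by
    refine IsSeqClosed.isClosed fun u a hu hua => ?_
    have ha : a ∈ Icc (0 : ℝ) 1 := isClosed_Icc.mem_of_tendsto hua (Eventually.of_forall fun k => (hu k).1)
    choose hI g hg using hu
    have hc : CauchySeq g := by
      refine Metric.cauchySeq_iff.2 fun ε hε => ?_
      have hd : 0 < dist x y + 1 := by positivity
      obtain ⟨N, hN⟩ := Metric.cauchySeq_iff.1 hua.cauchySeq (ε / (dist x y + 1)) (by positivity)
      refine ⟨N, fun k hk l hl => ?_⟩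
      have b1 := (hg l).dist_le (hg k) (hI k).1 (hI k).2 (hI l).1 (hI l).2
      have b2 := hN l hl k hk
      rw [Real.dist_eq, lt_div_iff₀ hd] at b2
      nlinarith [abs_nonneg (u l - u k)]
    obtain ⟨g₀, hg₀⟩ := cauchySeq_tendsto_of_complete hc
    refine ⟨ha, g₀, fun q => ?_⟩
    refine le_of_tendsto_of_tendsto ((tendsto_const_nhds.dist hg₀).pow 2)
      (((((tendsto_const_nhds (x := (1 : ℝ))).sub hua).mul_const _).add (hua.mul_const _)).sub
        ((hua.mul (tendsto_const_nhds.sub hua)).mul_const _)) (Eventually.of_forall fun k => hg k q)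
  suffices h : t ∈ T from h.2
  have hne1 : (T ∩ Iic t).Nonempty := ⟨0, h0, ht.1⟩
  have hne2 : (T ∩ Ici t).Nonempty := ⟨1, h1, ht.2⟩
  have hb1 : BddAbove (T ∩ Iic t) := ⟨t, fun z hz => hz.2⟩
  have hb2 : BddBelow (T ∩ Ici t) := ⟨t, fun z hz => hz.2⟩
  have ha := (hclosed.inter isClosed_Iic).csSup_mem hne1 hb1
  have hb := (hclosed.inter isClosed_Ici).csInf_mem hne2 hb2
  set a := sSup (T ∩ Iic t)
  set b := sInf (T ∩ Ici t)
  have hat : a ≤ t := ha.2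
  have htb : t ≤ b := hb.2
  rcases hat.eq_or_lt with h | hat
  · exact h ▸ ha.1
  rcases htb.eq_or_lt with h | htb
  · exact h ▸ hb.1
  have hm := hmid a ha.1 b hb.1 (by linarith)
  rcases le_total ((a + b) / 2) t with h | h
  · have := le_csSup hb1 ⟨hm, h⟩
    change _ ≤ a at this
    linarith
  · have := csInf_le hb2 ⟨hm, h⟩
    change b ≤ _ at this
    linarith

/-- Reshetnyak's quadruple inequality. -/
theorem IsHadamard.quadruple_sq (hQ : IsHadamard Q) (q p y z : Q) :
    dist q y ^ 2 + dist p z ^ 2 - dist q z ^ 2 - dist p y ^ 2 ≤ 2 * dist y z * dist q p := by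
  rcases (dist_nonneg (x := y) (y := z)).eq_or_lt with h0 | hu
  · obtain rfl := dist_eq_zero.1 h0.symm
    simp
  rcases (dist_nonneg (x := q) (y := p)).eq_or_lt with h0 | hv
  · obtain rfl := dist_eq_zero.1 h0.symm
    simp
  set u := dist y z
  set v := dist q p
  have huv : 0 < u + v := by positivity
  -- The point g divides the diagonal from q to y in the ratio v : u. The other diagonal is
  -- estimated through g by the weighted inequality (α+β)² ≤ ((u+v)/v)α² + ((u+v)/u)β². This ratio
  -- makes the side terms contribute uv each and the weights of d(q,y)² add up to 1.
  obtain ⟨g, hg⟩ := hQ.exists_isGeodesicPoint q y (t := v / (u + v))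
    ⟨by positivity, (div_le_one huv).2 (by linarith)⟩
  have h1 := hg z
  have h2 := hg p
  have h3 := dist_triangle_left p z g
  rw [dist_comm g p, dist_comm g z] at h3
  have h4 : dist p z ^ 2 ≤ (dist p g + dist z g) ^ 2 := by gcongr
  have h5 : (dist p g + dist z g) ^ 2 ≤ (u + v) / u * dist z g ^ 2 + (u + v) / v * dist p g ^ 2 := by
    have h6 : (u + v) / u * dist z g ^ 2 + (u + v) / v * dist p g ^ 2
        - (dist p g + dist z g) ^ 2 = (v * dist z g - u * dist p g) ^ 2 / (u * v) := by
      field_simp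
      ring
    have h7 : 0 ≤ (v * dist z g - u * dist p g) ^ 2 / (u * v) := by positivity
    linarith
  have h8 := mul_le_mul_of_nonneg_left h1 (show 0 ≤ (u + v) / u by positivity)
  have h9 := mul_le_mul_of_nonneg_left h2 (show 0 ≤ (u + v) / v by positivity)
  have e1 : (u + v) / u * ((1 - v / (u + v)) * dist q z ^ 2 + v / (u + v) * dist y z ^ 2
      - v / (u + v) * (1 - v / (u + v)) * dist q y ^ 2)
      = dist q z ^ 2 + u * v - v / (u + v) * dist q y ^ 2 := by
    change (u + v) / u * ((1 - v / (u + v)) * dist q z ^ 2 + v / (u + v) * u ^ 2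
      - v / (u + v) * (1 - v / (u + v)) * dist q y ^ 2) = _
    field_simp
    ring
  have e2 : (u + v) / v * ((1 - v / (u + v)) * dist q p ^ 2 + v / (u + v) * dist y p ^ 2
      - v / (u + v) * (1 - v / (u + v)) * dist q y ^ 2)
      = u * v + dist p y ^ 2 - u / (u + v) * dist q y ^ 2 := by
    rw [dist_comm y p]
    change (u + v) / v * ((1 - v / (u + v)) * v ^ 2 + v / (u + v) * dist p y ^ 2
      - v / (u + v) * (1 - v / (u + v)) * dist q y ^ 2) = _
    field_simp
    ring
  have e3 : v / (u + v) * dist q y ^ 2 + u / (u + v) * dist q y ^ 2 = dist q y ^ 2 := by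
    field_simp
    ring
  linarith

end Geodesic

/-! ### The quadruple inequality and strong convexity for transformed distances. -/

namespace IsTransformation

variable {τ : ℝ → ℝ}

/-- The real-variable core of the quadruple inequality. Increments of τ are replaced by length times
τ' at one point, and concavity of τ' merges the terms into a single s·τ'(p) whose area s·p the
quadratic inequality controls. Then `mul_transDeriv_le_of_mul_le` applies. -/
theorem quadruple_aux (h : IsTransformation τ) {u v a b c d : ℝ} (ha : 0 ≤ a) (hb : 0 ≤ b)
    (hc : 0 ≤ c) (hd : 0 ≤ d) (hv : 0 ≤ v)
    (hq : a ^ 2 + d ^ 2 - b ^ 2 - c ^ 2 ≤ 2 * u * v) (hab : |a - b| ≤ u) (hcd : |c - d| ≤ u)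
    (hac : |a - c| ≤ v) (hbd : |b - d| ≤ v) (huv : u ≤ v) :
    τ a - τ b - τ c + τ d ≤ 2 * u * transDeriv τ v := by
  wlog hba : b ≤ a generalizing a b c d
  -- If both increments have the favourable sign the left side is nonpositive; otherwise the
  -- symmetry (a,b,c,d) ↦ (d,c,b,a) reduces to b ≤ a.
  · rcases le_total d c with hdc | hcd'
    · have h1 := h.mono ha hb (by linarith : a ≤ b)
      have h2 := h.mono hd hc hdc
      have h3 := h.transDeriv_nonneg hv
      have h4 := (abs_nonneg _).trans hab
      have h5 : 0 ≤ 2 * u * transDeriv τ v := by positivity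
      linarith
    · have := this hd hc hb ha (by linarith) (by rwa [abs_sub_comm]) (by rwa [abs_sub_comm])
        (by rwa [abs_sub_comm]) (by rwa [abs_sub_comm]) hcd'
      linarith
  rw [abs_le] at *
  have hu : 0 ≤ u := by linarith
  have hma : 0 ≤ (a + b) / 2 := by positivity
  have h1 := h.sub_le_mul_transDeriv_midpoint hb hba
  have htv := h.transDeriv_nonneg hv
  rcases le_total c d with hcd' | hdc
  · have h2 := h.sub_le_mul_transDeriv_midpoint hc hcd'
    rcases (show 0 ≤ (a - b) + (d - c) by linarith).eq_or_lt with h0 | h0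
    · have e1 : a - b = 0 := by linarith
      have e2 : d - c = 0 := by linarith
      rw [e1, zero_mul] at h1
      rw [e2, zero_mul] at h2
      have : 0 ≤ 2 * u * transDeriv τ v := by positivity
      linarith
    · set s := (a - b) + (d - c) with hs
      have hmd : 0 ≤ (d + c) / 2 := by positivity
      have h3 := h.concaveOn_transDeriv.2 (show (a + b) / 2 ∈ Ici 0 from hma)
        (show (d + c) / 2 ∈ Ici 0 from hmd) (show 0 ≤ (a - b) / s from div_nonneg (by linarith) h0.le)
        (show 0 ≤ (d - c) / s from div_nonneg (by linarith) h0.le)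
        (by rw [← add_div]; exact div_self h0.ne')
      simp only [smul_eq_mul] at h3
      set p := (a - b) / s * ((a + b) / 2) + (d - c) / s * ((d + c) / 2) with hp
      have hp0 : 0 ≤ p := by
        have := div_nonneg (show 0 ≤ a - b by linarith) h0.le
        have := div_nonneg (show 0 ≤ d - c by linarith) h0.le
        positivity
      have hsp : s * p = (a ^ 2 + d ^ 2 - b ^ 2 - c ^ 2) / 2 := by
        rw [hp]
        field_simp
        ring
      have h4 := h.mul_transDeriv_le_of_mul_le (k := 1) (s := s) (u := 2 * u) (p := p) (v := v) le_rfl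
        h0.le (by linarith) hp0 hv (by nlinarith [mul_nonneg hu hv])
      have h5 := mul_le_mul_of_nonneg_left h3 h0.le
      have h6 : s * ((a - b) / s * transDeriv τ ((a + b) / 2)
          + (d - c) / s * transDeriv τ ((d + c) / 2)) = (a - b) * transDeriv τ ((a + b) / 2)
          + (d - c) * transDeriv τ ((d + c) / 2) := by
        field_simp
      linarith
  · have h2 := h.mul_transDeriv_le_sub hd hdc
    set s := a - b with hs
    set r := c - d with hr
    have hs0 : 0 ≤ s := by linarith
    have hr0 : 0 ≤ r := by linarith
    have htd := h.transDeriv_nonneg hd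
    have htma := h.transDeriv_nonneg hma
    -- Replacing τ c − τ d by its tangent bound at d costs an extra area r²/2. Since r² ≤ uv, the
    -- total stays below 2uv, which the factor 2 in the conclusion absorbs.
    have hsq : s * ((a + b) / 2) - r * d ≤ u * v + r * r / 2 := by
      rw [hs, hr]; nlinarith
    have hrr : r * r ≤ u * v := mul_le_mul (by linarith) (by linarith) hr0 hu
    suffices hgoal : s * transDeriv τ ((a + b) / 2) - r * transDeriv τ d
        ≤ 2 * u * transDeriv τ v by linarith
    rcases le_total d ((a + b) / 2) with hda | had
    · have h3 := h.transDeriv_add_le hd (sub_nonneg.2 hda)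
      rw [add_sub_cancel] at h3
      have hp0 : 0 ≤ (a + b) / 2 - d := by linarith
      rcases le_total s r with hsr | hrs
      · have h4 := h.mul_transDeriv_le_of_mul_le (k := 2) (s := s) (u := u)
          (p := (a + b) / 2 - d) (v := v) (by norm_num) hs0 (by linarith) hp0 hv
          (by
            have : (a + b) / 2 - d ≤ 2 * v := by linarith
            have := mul_le_mul (show s ≤ u by linarith) this hp0 hu
            linarith)
        have h5 := mul_le_mul_of_nonneg_left h3 hs0
        have h6 := mul_le_mul_of_nonneg_right hsr htd
        linarith
      · rcases hs0.eq_or_lt with h0 | h0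
        · have : r = 0 := by linarith
          rw [← h0, this]
          have : 0 ≤ 2 * u * transDeriv τ v := by positivity
          linarith
        -- Subadditivity of τ' around d cancels r·τ'(d). What remains, (s−r)τ' at the midpoint plus
        -- r·τ' at the midpoint minus d, is merged by concavity.
        have h3' := h.concaveOn_transDeriv.2 (show (a + b) / 2 ∈ Ici 0 from hma)
          (show (a + b) / 2 - d ∈ Ici 0 from hp0)
          (show 0 ≤ (s - r) / s from div_nonneg (by linarith) h0.le)
          (show 0 ≤ r / s from div_nonneg (by linarith) h0.le)
          (by rw [← add_div, sub_add_cancel]; exact div_self h0.ne')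
        simp only [smul_eq_mul] at h3'
        set p := (s - r) / s * ((a + b) / 2) + r / s * ((a + b) / 2 - d) with hp
        have hpn : 0 ≤ p := by
          have := div_nonneg (show 0 ≤ s - r by linarith) h0.le
          have := div_nonneg hr0 h0.le
          positivity
        have hsp : s * p = s * ((a + b) / 2) - r * d := by
          rw [hp]
          field_simp
          ring
        have h4 := h.mul_transDeriv_le_of_mul_le (k := 2) (s := s) (u := u) (p := p) (v := v)
          (by norm_num) hs0 (by linarith) hpn hv (by linarith [mul_nonneg hu hv])
        have h5 := mul_le_mul_of_nonneg_left h3' h0.le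
        have h6 : s * ((s - r) / s * transDeriv τ ((a + b) / 2)
            + r / s * transDeriv τ ((a + b) / 2 - d)) = (s - r) * transDeriv τ ((a + b) / 2)
            + r * transDeriv τ ((a + b) / 2 - d) := by
          field_simp
        have h7 := mul_le_mul_of_nonneg_left h3 hr0
        linarith
    · have h3 := h.transDeriv_mono hma had
      have h4 := mul_le_mul_of_nonneg_left h3 hr0
      rcases le_total s r with hsr | hrs
      · have h5 := mul_le_mul_of_nonneg_right hsr htma
        have : 0 ≤ 2 * u * transDeriv τ v := by positivity
        linarith
      · have h5 := h.mul_transDeriv_le_of_mul_le (k := 2) (s := s - r) (u := u)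
          (p := (a + b) / 2) (v := v) (by norm_num) (by linarith) (by linarith) hma hv
          (by
            have : r * (d - (a + b) / 2) ≤ r * (v - r / 2) :=
              mul_le_mul_of_nonneg_left (by linarith) hr0
            have : r * v ≤ u * v := mul_le_mul_of_nonneg_right (by linarith) hv
            nlinarith)
        linarith

/-- The quadruple inequality for transformed distances in Hadamard spaces. -/
theorem quadruple {Q : Type*} [MetricSpace Q] (hQ : IsHadamard Q) (h : IsTransformation τ)
    (q p y z : Q) : τ (dist y q) - τ (dist z q) - τ (dist y p) + τ (dist z p)
      ≤ 2 * dist y z * transDeriv τ (dist q p) := by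
  have hq := hQ.quadruple_sq q p y z
  rw [dist_comm q y, dist_comm p z, dist_comm q z, dist_comm p y] at hq
  have h1 : |dist y q - dist z q| ≤ dist y z := abs_dist_sub_le y z q
  have h2 : |dist y p - dist z p| ≤ dist y z := abs_dist_sub_le y z p
  have h3 : |dist y q - dist y p| ≤ dist q p := by
    rw [dist_comm y q, dist_comm y p]; exact abs_dist_sub_le q p y
  have h4 : |dist z q - dist z p| ≤ dist q p := by
    rw [dist_comm z q, dist_comm z p]; exact abs_dist_sub_le q p z
  rcases le_total (dist y z) (dist q p) with huv | hvu
  · exact h.quadruple_aux dist_nonneg dist_nonneg dist_nonneg dist_nonneg dist_nonneg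
      (by linarith) h1 h2 h3 h4 huv
  -- Exchanging the two pairs of points gives the bound 2vτ'(u) with v ≤ u, and vτ'(u) ≤ uτ'(v)
  -- because τ' is concave and nonnegative.
  · have h5 := h.quadruple_aux (a := dist y q) (b := dist y p) (c := dist z q) (d := dist z p)
      dist_nonneg dist_nonneg dist_nonneg dist_nonneg dist_nonneg
      (by linarith) h3 h4 h1 h2 hvu
    have h6 : dist q p * transDeriv τ (dist y z) ≤ 1 * dist y z * transDeriv τ (dist q p) :=
      h.mul_transDeriv_le_of_mul_le le_rfl dist_nonneg hvu dist_nonneg dist_nonneg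
        (by nlinarith)
    linarith

/-- Strong convexity of transformed distances along geodesics. -/
theorem strongConvexity {Q : Type*} [MetricSpace Q] (h : IsTransformation τ) {x q g : Q} {t : ℝ}
    (hg : IsGeodesicPoint x q t g) (ht : 0 ≤ t) (ht1 : t ≤ 1) (y : Q) :
    τ (dist y g) - τ (dist y x) ≤ t * (τ (dist y q) - τ (dist y x))
      - t * (1 - t) / 2 * dist x q ^ 2 * (transRightDeriv2 τ (dist y x + dist x q)).toReal := by
  set κ := (transRightDeriv2 τ (dist y x + dist x q)).toReal with hκ
  set L := dist y x + dist x q with hL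
  -- Distances from y along the geodesic are at most L, and κ is a lower bound for the slopes of τ'
  -- on [0, L]; hence f is nondecreasing and convex there. The subtracted quadratic part is
  -- recovered from the comparison inequality.
  set f : ℝ → ℝ := fun r => τ r - κ / 2 * r ^ 2 with hf
  have hcont : ContinuousOn f (Icc 0 L) :=
    (h.continuousOn.mono fun x hx => hx.1).sub (by fun_prop)
  have hderiv : ∀ r ∈ Ioo 0 L, HasDerivAt f (transDeriv τ r - κ * r) r := by
    intro r hr
    rw [transDeriv_of_pos hr.1]
    refine ((h.diff r hr.1).hasDerivAt.sub ((hasDerivAt_pow 2 r).const_mul (κ / 2))).congr_deriv ?_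
    simp
    ring
  have hmono : MonotoneOn f (Icc 0 L) := by
    refine monotoneOn_of_hasDerivWithinAt_nonneg (convex_Icc 0 L) hcont
      (f' := fun r => transDeriv τ r - κ * r) (fun r hr => ?_) fun r hr => ?_
    · rw [interior_Icc] at hr
      exact (hderiv r hr).hasDerivWithinAt
    · rw [interior_Icc] at hr
      have h1 := h.toReal_transRightDeriv2_mul_le le_rfl hr.1.le hr.2.le
      have h2 := h.transDeriv_nonneg (le_refl (0 : ℝ))
      rw [sub_zero] at h1
      linarith
  have hconv : ConvexOn ℝ (Icc 0 L) f := by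
    refine MonotoneOn.convexOn_of_deriv (convex_Icc 0 L) hcont
      (fun r hr => ?_) fun r hr r' hr' hrr' => ?_
    · rw [interior_Icc] at hr
      exact (hderiv r hr).differentiableAt.differentiableWithinAt
    · rw [interior_Icc] at hr hr'
      rw [(hderiv r hr).deriv, (hderiv r' hr').deriv]
      have h1 := h.toReal_transRightDeriv2_mul_le hr.1.le hrr' hr'.2.le
      linarith
  have h1t := sub_nonneg.2 ht1
  have hx : dist y x ∈ Icc 0 L := ⟨dist_nonneg, by simp [hL]⟩
  have hq : dist y q ∈ Icc 0 L := ⟨dist_nonneg, dist_triangle y x q⟩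
  have hle := hg.dist_le_convex ht ht1 y
  have hmem : (1 - t) * dist y x + t * dist y q ∈ Icc 0 L :=
    (convex_Icc 0 L) hx hq h1t ht (by ring)
  have h1 := hmono ⟨dist_nonneg, hle.trans hmem.2⟩ hmem hle
  have h2 := hconv.2 hx hq h1t ht (by ring)
  simp only [smul_eq_mul, hf] at h1 h2
  have h3 := mul_le_mul_of_nonneg_left (hg y) (show 0 ≤ κ / 2 by rw [hκ]; positivity)
  rw [dist_comm x y, dist_comm q y] at h3
  nlinarith

end IsTransformation

/-- Divide by t and let t → 0: this extracts a variance inequality from strong convexity along the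
geodesic leaving a minimizer. -/
theorem le_of_forall_mul_one_sub_le {A B : ℝ}
    (h : ∀ t ∈ Ioo (0 : ℝ) 1, t * (1 - t) * B ≤ t * A) : B ≤ A := by
  have h1 : Tendsto (fun t : ℝ => (1 - t) * B) (𝓝[>] 0) (𝓝 B) := by
    have : Tendsto (fun t : ℝ => (1 - t) * B) (𝓝 0) (𝓝 ((1 - 0) * B)) :=
      (by fun_prop : Continuous fun t : ℝ => (1 - t) * B).tendsto 0
    rw [sub_zero, one_mul] at this
    exact this.mono_left nhdsWithin_le_nhds
  refine le_of_tendsto h1 ?_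
  filter_upwards [Ioo_mem_nhdsGT one_pos] with t ht
  have := h t ht
  rw [mul_assoc] at this
  exact le_of_mul_le_mul_left this ht.1

/-! ### Sample Fréchet means: growth, uniqueness and measurable selection. -/

section Sample

variable {Q : Type*} [MetricSpace Q] {τ : ℝ → ℝ} {n : ℕ} {y : Fin n → Q} {x q : Q}

theorem isSampleFrechetMean_iff : IsSampleFrechetMean τ y x ↔
    ∀ q, ∑ j, τ (dist (y j) x) ≤ ∑ j, τ (dist (y j) q) :=
  isMinOn_univ_iff

/-- The variance inequality for a sample. -/
theorem IsSampleFrechetMean.variance_le (hQ : IsHadamard Q) (hτ : IsTransformation τ)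
    (hx : IsSampleFrechetMean τ y x) (q : Q) :
    dist x q ^ 2 / 2 * ∑ j, (transRightDeriv2 τ (dist (y j) x + dist x q)).toReal
      ≤ ∑ j, τ (dist (y j) q) - ∑ j, τ (dist (y j) x) := by
  refine le_of_forall_mul_one_sub_le fun t ht => ?_
  obtain ⟨g, hg⟩ := hQ.exists_isGeodesicPoint x q ⟨ht.1.le, ht.2.le⟩
  have h1 := Finset.sum_le_sum fun j (_ : j ∈ Finset.univ) =>
    hτ.strongConvexity hg ht.1.le ht.2.le (y j)
  simp only [Finset.sum_sub_distrib, ← Finset.mul_sum] at h1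
  have h2 := isSampleFrechetMean_iff.1 hx g
  linarith

/-- Linear growth of the objective away from a minimizer where it is strongly convex. -/
theorem IsSampleFrechetMean.exists_growth (hQ : IsHadamard Q) (hτ : IsTransformation τ)
    (hx : IsSampleFrechetMean τ y x) (hj : ∃ j, transRightDeriv2 τ (dist (y j) x) ≠ 0) {ε₀ : ℝ}
    (hε₀ : 0 < ε₀) : ∃ ε, 0 < ε ∧ ε ≤ ε₀ ∧ ∃ c, 0 < c ∧ ∀ q, ε ≤ dist x q →
      c * dist x q ≤ ∑ j, τ (dist (y j) q) - ∑ j, τ (dist (y j) x) := by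
  obtain ⟨j₀, hj₀⟩ := hj
  -- The variance inequality at distance ε involves τ'' at arguments enlarged by ε, so positivity is
  -- needed slightly to the right. It then gives a gain ε²S/2 at distance ε, which convexity along
  -- geodesics extends linearly.
  obtain ⟨δ, hδ, hδ'⟩ : ∃ δ, 0 < δ ∧ transRightDeriv2 τ (dist (y j₀) x + δ) ≠ 0 := by
    by_contra! hcon
    exact hj₀ (hτ.transRightDeriv2_eq_zero dist_nonneg hcon)
  set ε := min δ ε₀ with hε
  have hεpos : 0 < ε := lt_min hδ hε₀
  set S := ∑ j, (transRightDeriv2 τ (dist (y j) x + ε)).toReal with hS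
  have hSpos : 0 < S := by
    refine Finset.sum_pos' (fun j _ => ENNReal.toReal_nonneg) ⟨j₀, Finset.mem_univ _, ?_⟩
    refine ENNReal.toReal_pos ?_ (hτ.transRightDeriv2_lt_top (by positivity)).ne
    have hle : dist (y j₀) x + ε ≤ dist (y j₀) x + δ := by gcongr; exact min_le_left _ _
    have := hτ.antitoneOn_transRightDeriv2 (mem_Ici.2 (by positivity : 0 ≤ dist (y j₀) x + ε))
      (mem_Ici.2 (by positivity)) hle
    exact ((pos_iff_ne_zero.2 hδ').trans_le this).ne'
  refine ⟨ε, hεpos, min_le_right _ _, ε / 2 * S, by positivity, fun q hq => ?_⟩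
  have hD : 0 < dist x q := hεpos.trans_le hq
  have ht0 : 0 ≤ ε / dist x q := by positivity
  have ht1 : ε / dist x q ≤ 1 := (div_le_one hD).2 hq
  obtain ⟨g, hg⟩ := hQ.exists_isGeodesicPoint x q ⟨ht0, ht1⟩
  have hdg : dist x g = ε := by rw [hg.dist_left ht0 ht1, div_mul_cancel₀ _ hD.ne']
  have h1 := hx.variance_le hQ hτ g
  rw [hdg, ← hS] at h1
  have h2 := Finset.sum_le_sum fun j (_ : j ∈ Finset.univ) =>
    hτ.strongConvexity hg ht0 ht1 (y j)
  simp only [Finset.sum_sub_distrib, ← Finset.mul_sum] at h2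
  have h3 : 0 ≤ ε / dist x q * (1 - ε / dist x q) / 2 * dist x q ^ 2 *
      ∑ j, (transRightDeriv2 τ (dist (y j) x + dist x q)).toReal := by
    have := sub_nonneg.2 ht1
    have := Finset.sum_nonneg fun j (_ : j ∈ Finset.univ) =>
      ENNReal.toReal_nonneg (a := transRightDeriv2 τ (dist (y j) x + dist x q))
    positivity
  have h4 : ε ^ 2 / 2 * S ≤ ε / dist x q *
      (∑ j, τ (dist (y j) q) - ∑ j, τ (dist (y j) x)) := by linarith
  rw [div_mul_eq_mul_div ε, le_div_iff₀ hD] at h4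
  refine le_of_mul_le_mul_left ?_ hεpos
  linarith

theorem IsSampleFrechetMean.eq_of_ne_zero (hQ : IsHadamard Q) (hτ : IsTransformation τ)
    (hx : IsSampleFrechetMean τ y x) (hj : ∃ j, transRightDeriv2 τ (dist (y j) x) ≠ 0)
    (hq : IsSampleFrechetMean τ y q) : q = x := by
  by_contra hne
  have hD : 0 < dist x q := dist_pos.2 (Ne.symm hne)
  obtain ⟨ε, hε, hεD, c, hc, h⟩ := hx.exists_growth hQ hτ hj hD
  have h1 := h q hεD
  have h2 := isSampleFrechetMean_iff.1 hq x
  have := mul_pos hc hD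
  linarith

theorem exists_almost_minimizer [Nonempty Q] (hτ : IsTransformation τ) (y : Fin n → Q) {η : ℝ}
    (hη : 0 < η) : ∃ c, ∀ q, ∑ j, τ (dist (y j) c) ≤ ∑ j, τ (dist (y j) q) + η := by
  have hb : BddBelow (range fun q => ∑ j, τ (dist (y j) q)) :=
    ⟨0, by rintro _ ⟨q, rfl⟩; exact Finset.sum_nonneg fun j _ => hτ.nonneg dist_nonneg⟩
  obtain ⟨c, hc⟩ := exists_lt_of_ciInf_lt
    (show ⨅ q, ∑ j, τ (dist (y j) q) < (⨅ q, ∑ j, τ (dist (y j) q)) + η by linarith)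
  exact ⟨c, fun q => hc.le.trans (by gcongr; exact ciInf_le hb q)⟩

/-- An almost minimizer of a sample is an almost minimizer of nearby samples. -/
theorem almost_minimizer_perturb (hQ : IsHadamard Q) (hτ : IsTransformation τ)
    {y y' : Fin n → Q} {c : Q} {η : ℝ}
    (hc : ∀ q, ∑ j, τ (dist (y' j) c) ≤ ∑ j, τ (dist (y' j) q) + η)
    (hy : ∀ j, dist (y j) (y' j) ≤ η) (q : Q) :
    ∑ j, τ (dist (y j) c) - ∑ j, τ (dist (y j) q)
      ≤ η * (1 + 2 * n * transDeriv τ (dist q c)) := by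
  -- The quadruple inequality controls the change in the difference of two objective values by
  -- τ'(d(q,c)), independently of where the sample lies.
  have h1 := Finset.sum_le_sum fun j (_ : j ∈ Finset.univ) =>
    (hτ.quadruple hQ c q (y j) (y' j)).trans
      (mul_le_mul_of_nonneg_right (mul_le_mul_of_nonneg_left (hy j) zero_le_two)
        (hτ.transDeriv_nonneg dist_nonneg))
  simp only [Finset.sum_add_distrib, Finset.sum_sub_distrib, Finset.sum_const, Finset.card_univ,
    Fintype.card_fin, nsmul_eq_mul] at h1
  rw [dist_comm c q] at h1
  have h2 := hc q
  linarith

theorem IsTransformation.continuous_sum_dist (hτ : IsTransformation τ) (y : Fin n → Q) :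
    Continuous fun q => ∑ j, τ (dist (y j) q) :=
  continuous_finsetSum _ fun j _ => hτ.continuousOn.comp_continuous (by fun_prop)
    fun q => mem_Ici.2 dist_nonneg

/-- A strongly measurable selection of sample Fréchet means, for samples from a separable set. -/
theorem exists_stronglyMeasurable_sampleFrechetMean [MeasurableSpace Q] [BorelSpace Q]
    (hQ : IsHadamard Q) (hτ : IsTransformation τ) (n : ℕ) (s : ℕ → Q) :
    ∃ M : (Fin n → Q) → Q, StronglyMeasurable M ∧ ∃ G : Set (Fin n → Q), MeasurableSet G ∧
      (∀ y ∈ G, IsSampleFrechetMean τ y (M y)) ∧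
      ∀ y : Fin n → Q, (∀ j, y j ∈ closure (range s)) → ∀ x, IsSampleFrechetMean τ y x →
        (∃ j, transRightDeriv2 τ (dist (y j) x) ≠ 0) → y ∈ G ∧ M y = x := by
  classical
  have := hQ.complete
  have : Nonempty Q := ⟨s 0⟩
  set η : ℕ → ℝ := fun k => 1 / ((k : ℝ) + 1) with hη
  have hηpos : ∀ k, 0 < η k := fun k => Nat.one_div_pos_of_nat
  have hηlim : Tendsto η atTop (𝓝 0) := tendsto_one_div_add_atTop_nhds_zero_nat
  -- The second alternative makes the search for an approximating index total; outside the closure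
  -- the index is 0.
  have hp : ∀ k (q : Q), ∃ i, dist q (s i) < η k ∨ q ∉ closure (range s) := by
    intro k q
    by_cases hq : q ∈ closure (range s)
    · obtain ⟨_, ⟨i, rfl⟩, hi⟩ := Metric.mem_closure_iff.1 hq (η k) (hηpos k)
      exact ⟨i, Or.inl hi⟩
    · exact ⟨0, Or.inr hq⟩
  set l : ℕ → Q → ℕ := fun k q => Nat.find (hp k q) with hl
  have hlm : ∀ k, Measurable (l k) := fun k => by
    refine measurable_find (hp k) fun i => MeasurableSet.union ?_ ?_
    · exact measurableSet_lt (continuous_id.dist continuous_const).measurable measurable_const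
    · exact isClosed_closure.measurableSet.compl
  have hld : ∀ k, ∀ q ∈ closure (range s), dist q (s (l k q)) ≤ η k := fun k q hq =>
    ((Nat.find_spec (hp k q)).resolve_right (not_not.2 hq)).le
  choose c hc using fun (k : ℕ) (i : Fin n → ℕ) =>
    exists_almost_minimizer hτ (fun j => s (i j)) (hηpos k)
  -- Round each observation to a point of the dense sequence and look up an almost minimizer.
  -- Factoring through a countable discrete set gives strong measurability even when Q is not
  -- separable.
  set Mk : ℕ → (Fin n → Q) → Q := fun k y => c k fun j => l k (y j) with hMk
  have hMkm : ∀ k, StronglyMeasurable (Mk k) := fun k =>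
    (StronglyMeasurable.of_discrete (f := c k)).comp_measurable
      (measurable_pi_lambda _ fun j => (hlm k).comp (measurable_pi_apply j))
  have hbound : ∀ y : Fin n → Q, (∀ j, y j ∈ closure (range s)) → ∀ k q,
      ∑ j, τ (dist (y j) (Mk k y)) - ∑ j, τ (dist (y j) q)
        ≤ η k * (1 + 2 * n * transDeriv τ (dist q (Mk k y))) := fun y hy k q =>
    almost_minimizer_perturb hQ hτ (hc k _) (fun j => hld k _ (hy j)) q
  refine ⟨fun y => limUnder atTop fun k => Mk k y, StronglyMeasurable.limUnder hMkm,
    {y | ∀ j, y j ∈ closure (range s)} ∩ {y | ∃ x, Tendsto (fun k => Mk k y) atTop (𝓝 x)},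
    MeasurableSet.inter ?_ (StronglyMeasurable.measurableSet_exists_tendsto hMkm), ?_, ?_⟩
  · rw [show {y : Fin n → Q | ∀ j, y j ∈ closure (range s)}
      = ⋂ j, (fun y => y j) ⁻¹' closure (range s) by ext; simp]
    exact MeasurableSet.iInter fun j => measurable_pi_apply j isClosed_closure.measurableSet
  · rintro y ⟨hy, x, hx⟩
    beta_reduce
    rw [hx.limUnder_eq, isSampleFrechetMean_iff]
    intro q
    have h1 := ((hτ.continuous_sum_dist y).tendsto x).comp hx
    have h2 : Tendsto (fun k => η k * (1 + 2 * n * transDeriv τ (dist q x + 1))) atTop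
        (𝓝 (0 * (1 + 2 * n * transDeriv τ (dist q x + 1)))) := hηlim.mul_const _
    rw [zero_mul] at h2
    have h3 := le_of_tendsto_of_tendsto (h1.sub_const (∑ j, τ (dist (y j) q))) h2 ?_
    · linarith
    have h4 : ∀ᶠ k in atTop, dist (Mk k y) x < 1 := hx.eventually (Metric.ball_mem_nhds x one_pos)
    filter_upwards [h4] with k hk
    refine (hbound y hy k q).trans (mul_le_mul_of_nonneg_left ?_ (hηpos k).le)
    have : dist q (Mk k y) ≤ dist q x + 1 := by
      linarith [dist_triangle_right q (Mk k y) x, dist_triangle q x (Mk k y), dist_comm x (Mk k y)]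
    gcongr
    exact hτ.transDeriv_mono dist_nonneg this
  · intro y hy x hx hj
    have hlim : Tendsto (fun k => Mk k y) atTop (𝓝 x) := by
      refine Metric.tendsto_atTop'.2 fun ε₀ hε₀ => ?_
      obtain ⟨ε, hε, hεε₀, c', hc', hgrow⟩ := hx.exists_growth hQ hτ hj hε₀
      -- Beyond distance ε, τ' grows at most linearly, so the error of the k-th almost minimizer is
      -- at most this factor times the distance. Once the factor is below c', the linear growth of
      -- the objective excludes distances ≥ ε.
      have hlim : Tendsto (fun k => η k * (1 / ε + 2 * n * (transDeriv τ ε / ε))) atTop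
          (𝓝 (0 * (1 / ε + 2 * n * (transDeriv τ ε / ε)))) := hηlim.mul_const _
      rw [zero_mul] at hlim
      obtain ⟨N, hN⟩ := eventually_atTop.1 (hlim.eventually (gt_mem_nhds hc'))
      refine ⟨N, fun k hk => ?_⟩
      by_contra! hcon
      rw [dist_comm] at hcon
      have hD : ε ≤ dist x (Mk k y) := hεε₀.trans hcon
      have hDpos : 0 < dist x (Mk k y) := hε.trans_le hD
      have h1 := (hgrow _ hD).trans (hbound y hy k x)
      have h2 := hτ.transDeriv_mul_le (c := dist x (Mk k y) / ε) ((one_le_div hε).2 hD) hε.le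
      rw [div_mul_cancel₀ _ hε.ne'] at h2
      have h3 : 1 ≤ dist x (Mk k y) * (1 / ε) := by
        rw [mul_one_div]; exact (one_le_div hε).2 hD
      have h4 : 1 + 2 * n * transDeriv τ (dist x (Mk k y))
          ≤ dist x (Mk k y) * (1 / ε + 2 * n * (transDeriv τ ε / ε)) := by
        have h5 : 2 * n * transDeriv τ (dist x (Mk k y))
            ≤ 2 * n * (dist x (Mk k y) / ε * transDeriv τ ε) := by gcongr
        have h6 : 2 * (n : ℝ) * (dist x (Mk k y) / ε * transDeriv τ ε)
            = dist x (Mk k y) * (2 * n * (transDeriv τ ε / ε)) := by ring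
        rw [mul_add]
        linarith
      have h5 := mul_le_mul_of_nonneg_left h4 (hηpos k).le
      have h6 := mul_lt_mul_of_pos_left (hN k hk.le) hDpos
      linarith
    exact ⟨⟨hy, x, hlim⟩, hlim.limUnder_eq⟩

end Sample

/-! ### Integrability and the variance inequality for the population mean. -/

section Population

variable {Q : Type*} [MetricSpace Q] [MeasurableSpace Q] [BorelSpace Q] {τ : ℝ → ℝ}
  {μ : Measure Q} [IsProbabilityMeasure μ] {m : Q}

theorem integrable_transDeriv_dist (hτ : IsTransformation τ) {o : Q}
    (h : Integrable (fun y => transDeriv τ (dist y o)) μ) (q : Q) :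
    Integrable (fun y => transDeriv τ (dist y q)) μ := by
  refine (h.add (integrable_const (transDeriv τ (dist o q)))).mono'
    (hτ.measurable_transDeriv_comp (by fun_prop) fun _ => dist_nonneg).aestronglyMeasurable
    (ae_of_all _ fun y => ?_)
  rw [Real.norm_of_nonneg (hτ.transDeriv_nonneg dist_nonneg)]
  exact (hτ.transDeriv_mono dist_nonneg (dist_triangle y o q)).trans
    (hτ.transDeriv_add_le dist_nonneg dist_nonneg)

theorem integrable_transformation_sub (hτ : IsTransformation τ)
    (h : Integrable (fun y => transDeriv τ (dist y m)) μ) (q : Q) :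
    Integrable (fun y => τ (dist y q) - τ (dist y m)) μ := by
  refine ((h.add (integrable_const (transDeriv τ (dist m q)))).const_mul (dist q m)).mono'
    ((hτ.measurable_comp (by fun_prop) fun _ => dist_nonneg).sub
      (hτ.measurable_comp (by fun_prop) fun _ => dist_nonneg)).aestronglyMeasurable
    (ae_of_all _ fun y => ?_)
  have h1 := hτ.abs_sub_le (a := dist y q) (b := dist y m) (M := dist y m + dist m q) dist_nonneg
    dist_nonneg (dist_triangle y m q) (by linarith [dist_nonneg (x := m) (y := q)])
  refine h1.trans (mul_le_mul ?_ (hτ.transDeriv_add_le dist_nonneg dist_nonneg)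
    (hτ.transDeriv_nonneg (by positivity)) dist_nonneg)
  rw [dist_comm y q, dist_comm y m]
  exact abs_dist_sub_le q m y

/-- The variance inequality for a Fréchet mean. -/
theorem lintegral_transRightDeriv2_le (hQ : IsHadamard Q) (hτ : IsTransformation τ)
    (hint : Integrable (fun y => transDeriv τ (dist y m)) μ)
    (hm : ∀ q, 0 ≤ ∫ y, (τ (dist y q) - τ (dist y m)) ∂μ) (q : Q) :
    ∫⁻ y, ENNReal.ofReal (dist m q ^ 2) * transRightDeriv2 τ (dist y m + dist m q) ∂μ
      ≤ 2 * ENNReal.ofReal (∫ y, (τ (dist y q) - τ (dist y m)) ∂μ) := by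
  rcases (dist_nonneg (x := m) (y := q)).eq_or_lt with h0 | hD
  · simp [← h0]
  set L := ∫⁻ y, ENNReal.ofReal (dist m q ^ 2) * transRightDeriv2 τ (dist y m + dist m q) ∂μ
  set F := ∫ y, (τ (dist y q) - τ (dist y m)) ∂μ with hF
  have key : ∀ t ∈ Ioo (0 : ℝ) 1, ENNReal.ofReal (1 - t) * L ≤ 2 * ENNReal.ofReal F := by
    intro t ht
    have h1t : 0 < 1 - t := by linarith [ht.2]
    obtain ⟨g, hg⟩ := hQ.exists_isGeodesicPoint m q ⟨ht.1.le, ht.2.le⟩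
    have hq' := integrable_transformation_sub hτ hint q
    have hg' := integrable_transformation_sub hτ hint g
    -- The convexity gap divided by t. It is nonnegative and integrable, it dominates the τ'' term,
    -- and minimality of m against g bounds its integral by F; no integrability of τ'' has to be
    -- assumed.
    set f : Q → ℝ := fun y => (τ (dist y q) - τ (dist y m)) - t⁻¹ * (τ (dist y g) - τ (dist y m))
      with hf
    have hlow : ∀ y, (1 - t) / 2 * dist m q ^ 2 *
        (transRightDeriv2 τ (dist y m + dist m q)).toReal ≤ f y := by
      intro y
      have h1 := hτ.strongConvexity hg ht.1.le ht.2.le y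
      have h2 := mul_le_mul_of_nonneg_left h1 (inv_nonneg.2 ht.1.le)
      have h3 : t⁻¹ * (t * (τ (dist y q) - τ (dist y m)) - t * (1 - t) / 2 * dist m q ^ 2 *
          (transRightDeriv2 τ (dist y m + dist m q)).toReal) = (τ (dist y q) - τ (dist y m)) -
          (1 - t) / 2 * dist m q ^ 2 * (transRightDeriv2 τ (dist y m + dist m q)).toReal := by
        have := ht.1.ne'
        field_simp
      simp only [hf]
      linarith
    have hf0 : ∀ y, 0 ≤ f y := fun y => (by positivity : (0 : ℝ) ≤ _).trans (hlow y)
    have hfi : Integrable f μ := hq'.sub (hg'.const_mul _)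
    have hint_f : ∫ y, f y ∂μ ≤ F := by
      rw [hf, integral_sub hq' (hg'.const_mul _), integral_const_mul]
      have := mul_nonneg (inv_nonneg.2 ht.1.le) (hm g)
      linarith
    calc ENNReal.ofReal (1 - t) * L
        = ∫⁻ y, ENNReal.ofReal (1 - t) *
          (ENNReal.ofReal (dist m q ^ 2) * transRightDeriv2 τ (dist y m + dist m q)) ∂μ :=
          (lintegral_const_mul' _ _ ENNReal.ofReal_ne_top).symm
      _ ≤ ∫⁻ y, 2 * ENNReal.ofReal (f y) ∂μ := by
          refine lintegral_mono fun y => ?_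
          have hfin := (hτ.transRightDeriv2_lt_top (x := dist y m + dist m q) (by positivity)).ne
          have h2 : (2 : ℝ≥0∞) = ENNReal.ofReal 2 := by simp
          simp only
          rw [← ENNReal.ofReal_toReal hfin, ← ENNReal.ofReal_mul (by positivity),
            ← ENNReal.ofReal_mul h1t.le, h2, ← ENNReal.ofReal_mul zero_le_two]
          exact ENNReal.ofReal_le_ofReal (by linarith [hlow y])
      _ = 2 * ENNReal.ofReal (∫ y, f y ∂μ) := by
          rw [lintegral_const_mul' _ _ (by simp), ofReal_integral_eq_lintegral_ofReal hfi
            (ae_of_all _ hf0)]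
      _ ≤ 2 * ENNReal.ofReal F := by gcongr
  have hlim : Tendsto (fun t : ℝ => ENNReal.ofReal (1 - t) * L) (𝓝[>] 0) (𝓝 L) := by
    have h1 : Tendsto (fun t : ℝ => ENNReal.ofReal (1 - t)) (𝓝[>] 0) (𝓝 (ENNReal.ofReal (1 - 0))) :=
      ((ENNReal.continuous_ofReal.comp (continuous_const.sub continuous_id)).tendsto (0 : ℝ)).mono_left
        nhdsWithin_le_nhds
    have h2 := ENNReal.Tendsto.mul_const (b := L) h1 (Or.inl (by simp))
    simpa using h2
  refine le_of_tendsto hlim ?_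
  filter_upwards [Ioo_mem_nhdsGT one_pos] with t ht
  exact key t ht

end Population

/-- Without separability the distance need not be measurable for the product σ-algebra.
Approximating one argument by simple functions reduces to distances from fixed points. -/
theorem MeasureTheory.StronglyMeasurable.measurable_dist {α Q : Type*} [MeasurableSpace α]
    [MetricSpace Q] [MeasurableSpace Q] [BorelSpace Q] {f g : α → Q} (hf : StronglyMeasurable f)
    (hg : Measurable g) : Measurable fun a => dist (f a) (g a) := by
  have hc : ∀ q : Q, Measurable (dist q) := fun q => (continuous_const.dist continuous_id).measurable
  refine measurable_of_tendsto_metrizable (f := fun k a => dist (hf.approx k a) (g a))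
    (fun k => (hf.approx k).measurable_bind (fun q a => dist q (g a)) fun q => (hc q).comp hg) ?_
  exact tendsto_pi_nhds.2 fun a => (hf.tendsto_approx a).dist tendsto_const_nhds

/-- Exchange the `i`-th observation of a sample with an additional observation. -/
def exchange {Q : Type*} {n : ℕ} (i : Fin n) (z : (Fin n → Q) × Q) : (Fin n → Q) × Q :=
  (Function.update z.1 i z.2, z.1 i)

theorem exchange_exchange {Q : Type*} {n : ℕ} (i : Fin n) (z : (Fin n → Q) × Q) :
    exchange i (exchange i z) = z := by
  simp [exchange]

theorem measurable_exchange {Q : Type*} [MeasurableSpace Q] {n : ℕ} (i : Fin n) :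
    Measurable (exchange (Q := Q) i) := by
  refine Measurable.prodMk (measurable_pi_lambda _ fun j => ?_) (by fun_prop)
  by_cases h : j = i
  · subst h
    simpa using measurable_snd
  · simpa [h, Function.comp_def] using (measurable_pi_apply j).comp measurable_fst

/-! ### Stability of the sample mean for a fixed sample. -/

section Deterministic

variable {Q : Type*} [MetricSpace Q] {τ : ℝ → ℝ} {n : ℕ}

/-- The quadruple inequality in both directions, with d(x,y) split at m. Subadditivity of τ'
separates the contributions of the two observations. -/
theorem IsTransformation.abs_quadruple_le (hQ : IsHadamard Q) (hτ : IsTransformation τ)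
    (x y a b m : Q) :
    |(τ (dist y a) - τ (dist y b)) - (τ (dist x a) - τ (dist x b))|
      ≤ 2 * dist a b * (transDeriv τ (dist x m) + transDeriv τ (dist y m)) := by
  have h1 := hτ.quadruple hQ y x a b
  have h2 := hτ.quadruple hQ x y a b
  have h3 : transDeriv τ (dist y x) ≤ transDeriv τ (dist x m) + transDeriv τ (dist y m) := by
    rw [add_comm]
    refine (hτ.transDeriv_mono dist_nonneg (dist_triangle_right y x m)).trans
      (hτ.transDeriv_add_le dist_nonneg dist_nonneg)
  have h4 := mul_le_mul_of_nonneg_left h3 (show 0 ≤ 2 * dist a b by positivity)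
  rw [dist_comm x y] at h2
  rw [dist_comm a, dist_comm b, dist_comm a, dist_comm b] at h1 h2
  rw [abs_le]
  constructor <;> linarith

/-- The stability inequality: replacing one observation moves the sample Fréchet mean little. -/
theorem stability_le (hQ : IsHadamard Q) (hτ : IsTransformation τ) {x : Fin n → Q} {i : Fin n}
    {y a b : Q} (ha : IsSampleFrechetMean τ x a)
    (hb : IsSampleFrechetMean τ (Function.update x i y) b) :
    dist a b ^ 2 / 2 * (∑ j, (transRightDeriv2 τ (dist (x j) a + dist a b)).toReal +
      ∑ j, (transRightDeriv2 τ (dist (Function.update x i y j) b + dist b a)).toReal)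
      ≤ (τ (dist y a) - τ (dist y b)) - (τ (dist (x i) a) - τ (dist (x i) b)) := by
  have h1 := ha.variance_le hQ hτ b
  have h2 := hb.variance_le hQ hτ a
  have h3 : ∀ q, ∑ j, τ (dist (Function.update x i y j) q)
      = ∑ j, τ (dist (x j) q) - τ (dist (x i) q) + τ (dist y q) := by
    intro q
    rw [← Finset.add_sum_erase _ _ (Finset.mem_univ i),
      ← Finset.add_sum_erase _ (fun j => τ (dist (x j) q)) (Finset.mem_univ i),
      Function.update_self]
    have : ∑ j ∈ Finset.univ.erase i, τ (dist (Function.update x i y j) q)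
        = ∑ j ∈ Finset.univ.erase i, τ (dist (x j) q) :=
      Finset.sum_congr rfl fun j hj => by rw [Function.update_of_ne (Finset.ne_of_mem_erase hj)]
    rw [this]
    ring
  rw [h3, h3] at h2
  rw [dist_comm b a] at h2 ⊢
  rw [mul_add]
  linarith

theorem toReal_stabilityH (hτ : IsTransformation τ) (x : Fin n → Q) {a b : Q}
    (hab : 0 < dist a b) : stabilityH τ x a b ≠ ∞ ∧ (n : ℝ) * (stabilityH τ x a b).toReal
      = ∑ j, (transRightDeriv2 τ (dist (x j) a + dist a b)).toReal := by
  have hfin : ∀ j, transRightDeriv2 τ (dist (x j) a + dist a b) ≠ ∞ := fun j =>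
    (hτ.transRightDeriv2_lt_top (by positivity)).ne
  rcases n.eq_zero_or_pos with rfl | hn
  · simp [stabilityH]
  constructor
  · refine ENNReal.mul_ne_top (by simp [hn.ne']) (ENNReal.sum_ne_top.2 fun j _ => hfin j)
  · rw [stabilityH, ENNReal.toReal_mul, ENNReal.toReal_inv, ENNReal.toReal_natCast,
      ENNReal.toReal_sum fun j _ => hfin j, mul_inv_cancel_left₀ (by positivity)]

/-- Comparing the stability inequality with the quadruple bound 2·d(a,b)·T and cancelling one factor
d(a,b) gives d(a,b) ≤ 4T/(n(H+H')). The cases where d(a,b), T or H+H' vanishes are consistent with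
the `ℝ≥0∞` conventions. -/
theorem ofReal_dist_mul_le (hQ : IsHadamard Q) (hτ : IsTransformation τ) {x : Fin n → Q}
    {i : Fin n} {y a b m : Q} (ha : IsSampleFrechetMean τ x a)
    (hb : IsSampleFrechetMean τ (Function.update x i y) b) :
    ENNReal.ofReal (dist a b * (transDeriv τ (dist (x i) m) + transDeriv τ (dist y m)))
      ≤ 4 / n * (ENNReal.ofReal ((transDeriv τ (dist (x i) m) + transDeriv τ (dist y m)) ^ 2) *
        (stabilityH τ x a b + stabilityH τ (Function.update x i y) b a)⁻¹) := by
  set T := transDeriv τ (dist (x i) m) + transDeriv τ (dist y m) with hT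
  have hT0 : 0 ≤ T := add_nonneg (hτ.transDeriv_nonneg dist_nonneg)
    (hτ.transDeriv_nonneg dist_nonneg)
  have hn : (0 : ℝ) < n := by exact_mod_cast i.pos
  rcases (dist_nonneg (x := a) (y := b)).eq_or_lt with h0 | hd
  · simp [← h0]
  rcases hT0.eq_or_lt with hT0' | hTpos
  · simp [← hT0']
  obtain ⟨hf1, he1⟩ := toReal_stabilityH hτ x hd
  obtain ⟨hf2, he2⟩ := toReal_stabilityH hτ (Function.update x i y) (dist_comm a b ▸ hd)
  have h1 := stability_le hQ hτ ha hb
  have h2 := (le_abs_self _).trans (hτ.abs_quadruple_le hQ (x i) y a b m)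
  rw [← he1, ← he2, ← mul_add] at h1
  set H := stabilityH τ x a b
  set H' := stabilityH τ (Function.update x i y) b a
  have hfin : H + H' ≠ ∞ := ENNReal.add_ne_top.2 ⟨hf1, hf2⟩
  rw [← ENNReal.toReal_add hf1 hf2] at h1
  set h := (H + H').toReal with hh
  have h3 : dist a b * (n * h) ≤ 4 * T := by
    have h4 : dist a b * (dist a b * (n * h)) ≤ dist a b * (4 * T) := by linarith
    exact le_of_mul_le_mul_left h4 hd
  rcases (ENNReal.toReal_nonneg : 0 ≤ h).eq_or_lt with hh0 | hhpos
  · have hH0 : H + H' = 0 :=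
      ((ENNReal.toReal_eq_zero_iff _).1 hh0.symm).resolve_right hfin
    rw [hH0, ENNReal.inv_zero, ENNReal.mul_top (by simp; positivity), ENNReal.mul_top]
    · exact le_top
    · simp
  · have e1 : (4 : ℝ≥0∞) / n = ENNReal.ofReal (4 / n) := by
      rw [ENNReal.ofReal_div_of_pos hn, ENNReal.ofReal_natCast]
      simp
    rw [← ENNReal.ofReal_toReal hfin, ← hh, ← ENNReal.ofReal_inv_of_pos hhpos, e1,
      ← ENNReal.ofReal_mul (by positivity), ← ENNReal.ofReal_mul (by positivity)]
    refine ENNReal.ofReal_le_ofReal ?_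
    have e2 : 4 / (n : ℝ) * (T ^ 2 * h⁻¹) = (4 * T) / (n * h) * T := by
      field_simp
    rw [e2]
    refine mul_le_mul_of_nonneg_right ?_ hT0
    rwa [le_div_iff₀ (by positivity)]

/-- Dropping H' next to p and H next to q leaves two terms that the exchange of observations maps to
each other. -/
theorem ofReal_add_sq_mul_inv_le (p q : ℝ) (H H' : ℝ≥0∞) :
    ENNReal.ofReal ((p + q) ^ 2) * (H + H')⁻¹
      ≤ 2 * (ENNReal.ofReal (p ^ 2) * H⁻¹) + 2 * (ENNReal.ofReal (q ^ 2) * H'⁻¹) := by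
  have h2 : (2 : ℝ≥0∞) = ENNReal.ofReal 2 := by simp
  have h1 : ENNReal.ofReal ((p + q) ^ 2)
      ≤ 2 * ENNReal.ofReal (p ^ 2) + 2 * ENNReal.ofReal (q ^ 2) := by
    rw [h2, ← ENNReal.ofReal_mul zero_le_two, ← ENNReal.ofReal_mul zero_le_two,
      ← ENNReal.ofReal_add (by positivity) (by positivity)]
    exact ENNReal.ofReal_le_ofReal (by nlinarith [sq_nonneg (p - q)])
  calc ENNReal.ofReal ((p + q) ^ 2) * (H + H')⁻¹
      ≤ (2 * ENNReal.ofReal (p ^ 2) + 2 * ENNReal.ofReal (q ^ 2)) * (H + H')⁻¹ := by gcongr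
    _ = 2 * (ENNReal.ofReal (p ^ 2) * (H + H')⁻¹) + 2 * (ENNReal.ofReal (q ^ 2) * (H + H')⁻¹) := by
        ring
    _ ≤ _ := by
        gcongr
        · exact le_self_add
        · exact le_add_self

end Deterministic

/-! ### Exchangeability and the truncated excess loss. -/

section Exchange

variable {Q : Type*} [MetricSpace Q] {τ : ℝ → ℝ} {n : ℕ} {m : Q} {M : (Fin n → Q) → Q}

/-- The integrand of the stability bound. -/
noncomputable def stabilityIntegrand (τ : ℝ → ℝ) (m : Q) (M : (Fin n → Q) → Q) (i : Fin n)
    (z : (Fin n → Q) × Q) : ℝ≥0∞ :=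
  ENNReal.ofReal (transDeriv τ (dist (z.1 i) m) ^ 2) *
    (stabilityH τ z.1 (M z.1) (M (exchange i z).1))⁻¹

/-- The displacement of the sample Fréchet mean when the `i`-th observation is exchanged, weighted
by the derivative of the transformation. -/
noncomputable def exchangeCost (τ : ℝ → ℝ) (m : Q) (M : (Fin n → Q) → Q) (i : Fin n)
    (z : (Fin n → Q) × Q) : ℝ :=
  dist (M z.1) (M (exchange i z).1) *
    (transDeriv τ (dist (z.1 i) m) + transDeriv τ (dist z.2 m))

theorem exchangeCost_nonneg (hτ : IsTransformation τ) (i : Fin n) (z : (Fin n → Q) × Q) :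
    0 ≤ exchangeCost τ m M i z :=
  mul_nonneg dist_nonneg
    (add_nonneg (hτ.transDeriv_nonneg dist_nonneg) (hτ.transDeriv_nonneg dist_nonneg))

variable [MeasurableSpace Q] [BorelSpace Q]
  {μ : Measure Q}

theorem measurable_stabilityH {α : Type*} [MeasurableSpace α] (hτ : IsTransformation τ)
    {x : α → Fin n → Q} {a b : α → Q} (hx : Measurable x) (ha : StronglyMeasurable a)
    (hb : StronglyMeasurable b) : Measurable fun z => stabilityH τ (x z) (a z) (b z) := by
  refine Measurable.const_mul (Finset.measurable_sum _ fun j _ => ?_) _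
  refine hτ.measurable_transRightDeriv2_comp (Measurable.add ?_ (ha.measurable_dist hb.measurable))
    fun _ => by positivity
  simp_rw [dist_comm (x _ j)]
  exact ha.measurable_dist ((measurable_pi_apply j).comp hx)

theorem measurable_transDeriv_dist (hτ : IsTransformation τ) (m : Q) :
    Measurable fun y => transDeriv τ (dist y m) :=
  hτ.measurable_transDeriv_comp (continuous_id.dist continuous_const).measurable
    fun _ => dist_nonneg

theorem measurable_transformation_dist (hτ : IsTransformation τ) (m : Q) :
    Measurable fun y => τ (dist y m) :=
  hτ.measurable_comp (continuous_id.dist continuous_const).measurable fun _ => dist_nonneg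

theorem measurable_stabilityIntegrand (hτ : IsTransformation τ) (hM : StronglyMeasurable M)
    (i : Fin n) : Measurable (stabilityIntegrand τ m M i) := by
  refine Measurable.mul ?_ (measurable_stabilityH hτ measurable_fst
    (hM.comp_measurable measurable_fst)
    (hM.comp_measurable (measurable_exchange i).fst)).inv
  exact (((measurable_transDeriv_dist hτ m).comp
    ((measurable_pi_apply i).comp measurable_fst)).pow_const 2).ennreal_ofReal

theorem measurable_exchangeCost (hτ : IsTransformation τ) (hM : StronglyMeasurable M)
    (i : Fin n) : Measurable (exchangeCost τ m M i) :=
  ((hM.comp_measurable measurable_fst).measurable_dist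
    (hM.measurable.comp (measurable_exchange i).fst)).mul
    (((measurable_transDeriv_dist hτ m).comp ((measurable_pi_apply i).comp measurable_fst)).add
      ((measurable_transDeriv_dist hτ m).comp measurable_snd))

/-- The pointwise bound is (4/n)(2g + 2g∘exchange) for the stability integrand g. Invariance of the
law equates the two integrals, whence 16/n. -/
theorem lintegral_exchangeCost_le (hQ : IsHadamard Q) (hτ : IsTransformation τ)
    (hM : StronglyMeasurable M)
    (hgood : ∀ᵐ x ∂(Measure.pi fun _ : Fin n => μ), IsSampleFrechetMean τ x (M x)) (i : Fin n)
    (hσ : MeasurePreserving (exchange i) ((Measure.pi fun _ : Fin n => μ).prod μ)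
      ((Measure.pi fun _ : Fin n => μ).prod μ)) :
    ∫⁻ z, ENNReal.ofReal (exchangeCost τ m M i z) ∂((Measure.pi fun _ : Fin n => μ).prod μ)
      ≤ 16 / n * ∫⁻ z, stabilityIntegrand τ m M i z ∂((Measure.pi fun _ : Fin n => μ).prod μ) := by
  set ρ := (Measure.pi fun _ : Fin n => μ).prod μ
  have hg := measurable_stabilityIntegrand (m := m) hτ hM i
  have h1 : ∀ᵐ z ∂ρ, IsSampleFrechetMean τ z.1 (M z.1) :=
    Measure.quasiMeasurePreserving_fst.ae hgood
  have h2 : ∀ᵐ z ∂ρ, IsSampleFrechetMean τ (exchange i z).1 (M (exchange i z).1) :=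
    hσ.quasiMeasurePreserving.ae h1
  calc ∫⁻ z, ENNReal.ofReal (exchangeCost τ m M i z) ∂ρ
      ≤ ∫⁻ z, 4 / n * (2 * stabilityIntegrand τ m M i z +
          2 * stabilityIntegrand τ m M i (exchange i z)) ∂ρ := by
        refine lintegral_mono_ae ?_
        filter_upwards [h1, h2] with z hz1 hz2
        refine (ofReal_dist_mul_le hQ hτ hz1 hz2).trans ?_
        gcongr
        refine (ofReal_add_sq_mul_inv_le _ _ _ _).trans (le_of_eq ?_)
        have h3 : (exchange i z).1 i = z.2 := by simp [exchange]
        rw [stabilityIntegrand, stabilityIntegrand, exchange_exchange, h3]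
        rfl
    _ = 4 / n * (2 * ∫⁻ z, stabilityIntegrand τ m M i z ∂ρ +
          2 * ∫⁻ z, stabilityIntegrand τ m M i (exchange i z) ∂ρ) := by
        rw [lintegral_const_mul _ (by have := measurable_exchange (Q := Q) i; fun_prop),
          lintegral_add_left (by fun_prop), lintegral_const_mul _ hg,
          lintegral_const_mul _ (show Measurable fun z => stabilityIntegrand τ m M i (exchange i z) from
            hg.comp (measurable_exchange i))]
    _ = 16 / n * ∫⁻ z, stabilityIntegrand τ m M i z ∂ρ := by
        rw [hσ.lintegral_comp hg]
        rw [← two_mul, ← mul_assoc, ← mul_assoc]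
        congr 1
        rw [div_eq_mul_inv, div_eq_mul_inv]
        ring

variable [IsProbabilityMeasure μ]

/-- The excess loss of the sample Fréchet mean at an additional observation, compared with the
`i`-th observation. -/
noncomputable def excessDiff (τ : ℝ → ℝ) (m : Q) (M : (Fin n → Q) → Q) (i : Fin n)
    (z : (Fin n → Q) × Q) : ℝ :=
  (τ (dist z.2 (M z.1)) - τ (dist z.2 m)) - (τ (dist (z.1 i) (M z.1)) - τ (dist (z.1 i) m))

theorem measurable_excessDiff (hτ : IsTransformation τ) (hM : StronglyMeasurable M)
    (i : Fin n) : Measurable (excessDiff τ m M i) := by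
  have h1 : Measurable fun z : (Fin n → Q) × Q => dist z.2 (M z.1) := by
    simp_rw [dist_comm _ (M _)]
    exact (hM.comp_measurable measurable_fst).measurable_dist measurable_snd
  have h2 : Measurable fun z : (Fin n → Q) × Q => dist (z.1 i) (M z.1) := by
    simp_rw [dist_comm _ (M _)]
    exact (hM.comp_measurable measurable_fst).measurable_dist
      ((measurable_pi_apply i).comp measurable_fst)
  exact ((hτ.measurable_comp h1 fun _ => dist_nonneg).sub
    ((measurable_transformation_dist hτ m).comp measurable_snd)).sub
    ((hτ.measurable_comp h2 fun _ => dist_nonneg).sub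
    ((measurable_transformation_dist hτ m).comp ((measurable_pi_apply i).comp measurable_fst)))

/-- A cutoff that is slowly varying at scale `K`. -/
noncomputable def cutoff (K r : ℝ) : ℝ := K / (K + r)

/-- The excess difference is of order d(M,m)·T, where only T is known to be integrable; the cutoff
bounds d(M,m) by K. -/
theorem integrable_excessDiff_mul_cutoff (hQ : IsHadamard Q) (hτ : IsTransformation τ)
    (hint : Integrable (fun y => transDeriv τ (dist y m)) μ) (hM : StronglyMeasurable M)
    (i : Fin n) {K : ℝ} (hK : 0 < K) :
    Integrable (fun z => excessDiff τ m M i z * cutoff K (dist (M z.1) m))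
      ((Measure.pi fun _ : Fin n => μ).prod μ) := by
  have hi1 : Integrable (fun z : (Fin n → Q) × Q => transDeriv τ (dist (z.1 i) m))
      ((Measure.pi fun _ : Fin n => μ).prod μ) :=
    ((measurePreserving_eval (fun _ : Fin n => μ) i).comp measurePreserving_fst).integrable_comp_of_integrable
      hint
  have hi2 : Integrable (fun z : (Fin n → Q) × Q => transDeriv τ (dist z.2 m))
      ((Measure.pi fun _ : Fin n => μ).prod μ) :=
    (measurePreserving_snd).integrable_comp_of_integrable hint
  have hD : Measurable fun z : (Fin n → Q) × Q => dist (M z.1) m :=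
    (hM.comp_measurable measurable_fst).measurable_dist measurable_const
  refine ((hi1.add hi2).const_mul (2 * K)).mono' ((measurable_excessDiff hτ hM i).mul
    (measurable_const.div (measurable_const.add hD))).aestronglyMeasurable (ae_of_all _ fun z => ?_)
  have h1 := hτ.abs_quadruple_le hQ (z.1 i) z.2 (M z.1) m m
  have hT : 0 ≤ transDeriv τ (dist (z.1 i) m) + transDeriv τ (dist z.2 m) :=
    add_nonneg (hτ.transDeriv_nonneg dist_nonneg) (hτ.transDeriv_nonneg dist_nonneg)
  have hc : 0 ≤ cutoff K (dist (M z.1) m) := by unfold cutoff; positivity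
  have hcD : dist (M z.1) m * cutoff K (dist (M z.1) m) ≤ K := by
    rw [cutoff, mul_div_assoc', div_le_iff₀ (by positivity)]
    nlinarith [dist_nonneg (x := M z.1) (y := m)]
  rw [norm_mul, Real.norm_of_nonneg hc]
  calc ‖excessDiff τ m M i z‖ * cutoff K (dist (M z.1) m)
      ≤ 2 * dist (M z.1) m * (transDeriv τ (dist (z.1 i) m) + transDeriv τ (dist z.2 m)) *
        cutoff K (dist (M z.1) m) := mul_le_mul_of_nonneg_right h1 hc
    _ = 2 * (dist (M z.1) m * cutoff K (dist (M z.1) m)) *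
        (transDeriv τ (dist (z.1 i) m) + transDeriv τ (dist z.2 m)) := by ring
    _ ≤ 2 * K * (transDeriv τ (dist (z.1 i) m) + transDeriv τ (dist z.2 m)) := by gcongr

/-- Exchangeability bounds the truncated excess loss by the cost of an exchange, up to an error
that vanishes as the cutoff is removed. -/
theorem integral_excessDiff_le (hQ : IsHadamard Q) (hτ : IsTransformation τ)
    (hint : Integrable (fun y => transDeriv τ (dist y m)) μ) (hM : StronglyMeasurable M)
    (i : Fin n)
    (hσ : MeasurePreserving (exchange i) ((Measure.pi fun _ : Fin n => μ).prod μ)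
      ((Measure.pi fun _ : Fin n => μ).prod μ))
    (hW : Integrable (exchangeCost τ m M i) ((Measure.pi fun _ : Fin n => μ).prod μ)) {K : ℝ}
    (hK : 0 < K) :
    ∫ z, excessDiff τ m M i z * cutoff K (dist (M z.1) m) ∂((Measure.pi fun _ : Fin n => μ).prod μ)
      ≤ ∫ z, exchangeCost τ m M i z *
        (1 + (1 - cutoff K (dist (M (exchange i z).1) m)))
          ∂((Measure.pi fun _ : Fin n => μ).prod μ) := by
  set ρ := (Measure.pi fun _ : Fin n => μ).prod μ
  have hZ := integrable_excessDiff_mul_cutoff hQ hτ hint hM i hK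
  have hZ' := (hσ.integrable_comp_of_integrable hZ)
  have hDm : Measurable fun z : (Fin n → Q) × Q => dist (M (exchange i z).1) m :=
    (hM.comp_measurable (measurable_exchange i).fst).measurable_dist measurable_const
  have hcut : ∀ z : (Fin n → Q) × Q, 0 ≤ cutoff K (dist (M z.1) m) ∧
      cutoff K (dist (M z.1) m) ≤ 1 := fun z =>
    ⟨by unfold cutoff; positivity, by
      unfold cutoff
      rw [div_le_one (by positivity)]
      linarith [dist_nonneg (x := M z.1) (y := m)]⟩
  have hWi : Integrable (fun z => exchangeCost τ m M i z *
      (1 + (1 - cutoff K (dist (M (exchange i z).1) m)))) ρ := by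
    refine hW.mul_bdd (c := 2) ?_ (ae_of_all _ fun z => ?_)
    · exact (measurable_const.add (measurable_const.sub
        (measurable_const.div (measurable_const.add hDm)))).aestronglyMeasurable
    · have := hcut (exchange i z)
      rw [Real.norm_of_nonneg (by linarith)]
      linarith
  -- With Z' and b the exchanged versions of Z and a, and χ the cutoff as a function of the mean,
  -- write the sum as (Z + Z')χ(a) + Z'(χ(b) − χ(a)). In Z + Z' the terms at m cancel, leaving the
  -- quadruple expression in a and b.
  have hpt : ∀ z, excessDiff τ m M i z * cutoff K (dist (M z.1) m) +
      excessDiff τ m M i (exchange i z) * cutoff K (dist (M (exchange i z).1) m)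
      ≤ 2 * (exchangeCost τ m M i z *
        (1 + (1 - cutoff K (dist (M (exchange i z).1) m)))) := by
    intro z
    set a := M z.1 with ha
    set b := M (exchange i z).1 with hb
    set T := transDeriv τ (dist (z.1 i) m) + transDeriv τ (dist z.2 m) with hT
    have hT0 : 0 ≤ T :=
      add_nonneg (hτ.transDeriv_nonneg dist_nonneg) (hτ.transDeriv_nonneg dist_nonneg)
    have e1 : excessDiff τ m M i (exchange i z) =
        (τ (dist (z.1 i) b) - τ (dist (z.1 i) m)) - (τ (dist z.2 b) - τ (dist z.2 m)) := by
      simp [excessDiff, exchange, hb]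
    have e2 : excessDiff τ m M i z =
        (τ (dist z.2 a) - τ (dist z.2 m)) - (τ (dist (z.1 i) a) - τ (dist (z.1 i) m)) := rfl
    have e3 : exchangeCost τ m M i z = dist a b * T := rfl
    have h1 := (le_abs_self _).trans (hτ.abs_quadruple_le hQ (z.1 i) z.2 a b m)
    have h2 := hτ.abs_quadruple_le hQ z.2 (z.1 i) b m m
    rw [← e1, add_comm (transDeriv τ (dist z.2 m)), ← hT] at h2
    have hca := hcut z
    have hcb := hcut (exchange i z)
    rw [← ha] at hca
    rw [← hb] at hcb
    set Z := excessDiff τ m M i z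
    set Z' := excessDiff τ m M i (exchange i z)
    have h3 : Z + Z' ≤ 2 * (dist a b * T) := by rw [e1, e2]; linarith
    -- Slow variation of the cutoff: the factor d(b,m) in the bound for Z' is traded for d(a,b), so
    -- the error is at most a multiple of the exchange cost times 1 − χ(b), which tends to 0 as K →
    -- ∞.
    have h4 : dist b m * |cutoff K (dist b m) - cutoff K (dist a m)|
        ≤ dist a b * (1 - cutoff K (dist b m)) := by
      have hpa : 0 < K + dist a m := by positivity
      have hpb : 0 < K + dist b m := by positivity
      have e4 : cutoff K (dist b m) - cutoff K (dist a m) =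
          cutoff K (dist a m) * ((dist a m - dist b m) / (K + dist b m)) := by
        unfold cutoff
        field_simp
        ring
      have e5 : 1 - cutoff K (dist b m) = dist b m / (K + dist b m) := by
        unfold cutoff
        field_simp
        ring
      rw [e4, e5, abs_mul, abs_div, abs_of_nonneg hca.1, abs_of_pos hpb]
      have h5 : |dist a m - dist b m| ≤ dist a b := abs_dist_sub_le a b m
      calc dist b m * (cutoff K (dist a m) * (|dist a m - dist b m| / (K + dist b m)))
          ≤ dist b m * (1 * (dist a b / (K + dist b m))) := by
            gcongr
            exact hca.2
        _ = dist a b * (dist b m / (K + dist b m)) := by ring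
    have h6 : Z' * (cutoff K (dist b m) - cutoff K (dist a m))
        ≤ 2 * T * (dist a b * (1 - cutoff K (dist b m))) := by
      calc Z' * (cutoff K (dist b m) - cutoff K (dist a m))
          ≤ |Z'| * |cutoff K (dist b m) - cutoff K (dist a m)| := by
            rw [← abs_mul]; exact le_abs_self _
        _ ≤ 2 * dist b m * T * |cutoff K (dist b m) - cutoff K (dist a m)| := by gcongr
        _ = 2 * T * (dist b m * |cutoff K (dist b m) - cutoff K (dist a m)|) := by ring
        _ ≤ _ := by gcongr
    have h7 : (Z + Z') * cutoff K (dist a m) ≤ 2 * (dist a b * T) := by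
      have : 0 ≤ 2 * (dist a b * T) := by positivity
      calc (Z + Z') * cutoff K (dist a m) ≤ 2 * (dist a b * T) * cutoff K (dist a m) :=
            mul_le_mul_of_nonneg_right h3 hca.1
        _ ≤ 2 * (dist a b * T) := mul_le_of_le_one_right this hca.2
    rw [e3]
    linarith
  have hsum := integral_mono (hZ.add hZ') (hWi.const_mul 2) hpt
  rw [integral_const_mul] at hsum
  have hadd : ∫ z, ((fun z => excessDiff τ m M i z * cutoff K (dist (M z.1) m)) +
      (fun z => excessDiff τ m M i z * cutoff K (dist (M z.1) m)) ∘ exchange i) z ∂ρ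
      = 2 * ∫ z, excessDiff τ m M i z * cutoff K (dist (M z.1) m) ∂ρ := by
    have h1 := integral_add hZ hZ'
    have h2 : ∫ z, ((fun z => excessDiff τ m M i z * cutoff K (dist (M z.1) m)) ∘ exchange i) z ∂ρ
        = ∫ z, excessDiff τ m M i z * cutoff K (dist (M z.1) m) ∂ρ := by
      conv_rhs => rw [← hσ.map_eq]
      rw [integral_map hσ.aemeasurable (by rw [hσ.map_eq]; exact hZ.aestronglyMeasurable)]
      rfl
    rw [h2] at h1
    simp only [Pi.add_apply]
    rw [h1]
    ring
  rw [hadd] at hsum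
  linarith

end Exchange

/-! ### Removal of the cutoff and the bound on the product space. -/

section Bound

variable {Q : Type*} [MetricSpace Q] [MeasurableSpace Q] [BorelSpace Q] {τ : ℝ → ℝ} {n : ℕ}
  {μ : Measure Q} {m : Q} {M : (Fin n → Q) → Q}

theorem cutoff_mem_Icc {K r : ℝ} (hK : 0 < K) (hr : 0 ≤ r) : cutoff K r ∈ Icc 0 1 := by
  unfold cutoff
  exact ⟨by positivity, by rw [div_le_one (by positivity)]; linarith⟩

theorem tendsto_cutoff (r : ℝ) :
    Tendsto (fun k : ℕ => cutoff ((k : ℝ) + 1) r) atTop (𝓝 1) := by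
  have h0 : Tendsto (fun k : ℕ => (k : ℝ) + 1) atTop atTop :=
    tendsto_atTop_add_const_right _ _ tendsto_natCast_atTop_atTop
  have h1 : Tendsto (fun k : ℕ => 1 - r / ((k : ℝ) + 1 + r)) atTop (𝓝 (1 - 0)) :=
    tendsto_const_nhds.sub (tendsto_const_nhds.div_atTop (tendsto_atTop_add_const_right _ _ h0))
  rw [sub_zero] at h1
  refine h1.congr' ?_
  filter_upwards [(tendsto_atTop_add_const_right _ r h0).eventually_gt_atTop 0] with k hk
  unfold cutoff
  field_simp
  ring

theorem monotone_cutoff {r : ℝ} (hr : 0 ≤ r) : Monotone fun k : ℕ => cutoff ((k : ℝ) + 1) r := by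
  intro k l hkl
  have hkl' : (k : ℝ) ≤ l := by exact_mod_cast hkl
  simp only [cutoff]
  rw [div_le_div_iff₀ (by positivity) (by positivity)]
  nlinarith

theorem tendsto_integral_exchangeCost (hM : StronglyMeasurable M) (i : Fin n)
    (hW : Integrable (exchangeCost τ m M i) ((Measure.pi fun _ : Fin n => μ).prod μ)) :
    Tendsto (fun k : ℕ => ∫ z, exchangeCost τ m M i z *
        (1 + (1 - cutoff ((k : ℝ) + 1) (dist (M (exchange i z).1) m)))
          ∂((Measure.pi fun _ : Fin n => μ).prod μ)) atTop
      (𝓝 (∫ z, exchangeCost τ m M i z ∂((Measure.pi fun _ : Fin n => μ).prod μ))) := by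
  have hDm : Measurable fun z : (Fin n → Q) × Q => dist (M (exchange i z).1) m :=
    (hM.comp_measurable (measurable_exchange i).fst).measurable_dist measurable_const
  refine tendsto_integral_of_dominated_convergence (fun z => ‖exchangeCost τ m M i z‖ * 2)
    (fun k => hW.aestronglyMeasurable.mul (measurable_const.add (measurable_const.sub
        (measurable_const.div (measurable_const.add hDm)))).aestronglyMeasurable)
    (hW.norm.mul_const 2) (fun k => ae_of_all _ fun z => ?_) (ae_of_all _ fun z => ?_)
  · have := cutoff_mem_Icc (K := (k : ℝ) + 1) (by positivity)
      (dist_nonneg (x := M (exchange i z).1) (y := m))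
    rw [norm_mul]
    gcongr
    rw [Real.norm_of_nonneg (by linarith [this.2])]
    linarith [this.1]
  · have h1 := ((tendsto_cutoff (dist (M (exchange i z).1) m)).const_sub 1).const_add 1
    simpa using h1.const_mul (exchangeCost τ m M i z)

theorem measurable_weighted_dist_sq (hτ : IsTransformation τ) (hM : StronglyMeasurable M) :
    Measurable fun z : (Fin n → Q) × Q => ENNReal.ofReal (dist m (M z.1) ^ 2) *
      transRightDeriv2 τ (dist z.2 m + dist m (M z.1)) := by
  have hDm : Measurable fun z : (Fin n → Q) × Q => dist m (M z.1) := by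
    simp_rw [dist_comm m]
    exact (hM.comp_measurable measurable_fst).measurable_dist measurable_const
  refine (hDm.pow_const 2).ennreal_ofReal.mul
    (hτ.measurable_transRightDeriv2_comp (Measurable.add ?_ hDm) fun _ => by positivity)
  exact (continuous_id.dist continuous_const).measurable.comp measurable_snd

variable [IsProbabilityMeasure μ]

/-- The truncated excess risk of the sample Fréchet mean. -/
theorem lintegral_cutoff_excess_le (hQ : IsHadamard Q) (hτ : IsTransformation τ) (hn : 0 < n)
    (hint : Integrable (fun y => transDeriv τ (dist y m)) μ)
    (hm : ∀ q, 0 ≤ ∫ y, (τ (dist y q) - τ (dist y m)) ∂μ) (hM : StronglyMeasurable M)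
    (hgood : ∀ᵐ x ∂(Measure.pi fun _ : Fin n => μ), IsSampleFrechetMean τ x (M x)) {K : ℝ}
    (hK : 0 < K) :
    ∫⁻ x, ENNReal.ofReal (cutoff K (dist (M x) m) *
        ∫ y, (τ (dist y (M x)) - τ (dist y m)) ∂μ) ∂(Measure.pi fun _ : Fin n => μ)
      ≤ ENNReal.ofReal ((n : ℝ)⁻¹ * ∑ i, ∫ z, excessDiff τ m M i z * cutoff K (dist (M z.1) m)
          ∂((Measure.pi fun _ : Fin n => μ).prod μ)) := by
  set ν := Measure.pi fun _ : Fin n => μ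
  have hn' : (0 : ℝ) < n := by exact_mod_cast hn
  have hZ := fun i => integrable_excessDiff_mul_cutoff hQ hτ hint hM i hK
  set I : Fin n → (Fin n → Q) → ℝ := fun i x =>
    ∫ y, excessDiff τ m M i (x, y) * cutoff K (dist (M x) m) ∂μ with hI
  have hIi : ∀ i, Integrable (I i) ν := fun i => (hZ i).integral_prod_left
  have hIint : ∀ i, ∫ x, I i x ∂ν = ∫ z, excessDiff τ m M i z * cutoff K (dist (M z.1) m)
      ∂(ν.prod μ) := fun i => (integral_prod _ (hZ i)).symm
  have hIeq : ∀ i x, I i x = cutoff K (dist (M x) m) *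
      (∫ y, (τ (dist y (M x)) - τ (dist y m)) ∂μ - (τ (dist (x i) (M x)) - τ (dist (x i) m))) := by
    intro i x
    simp only [hI, excessDiff]
    rw [integral_mul_const, integral_sub (integrable_transformation_sub hτ hint _)
      (integrable_const _), integral_const]
    simp [mul_comm]
  have hc : ∀ x, 0 ≤ cutoff K (dist (M x) m) := fun x => (cutoff_mem_Icc hK dist_nonneg).1
  -- The sample excess loss of M x over m is nonpositive by minimality, so subtracting its average
  -- only increases the right side.
  have hle : ∀ᵐ x ∂ν, cutoff K (dist (M x) m) * ∫ y, (τ (dist y (M x)) - τ (dist y m)) ∂μ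
      ≤ (n : ℝ)⁻¹ * ∑ i, I i x := by
    filter_upwards [hgood] with x hx
    have h1 := isSampleFrechetMean_iff.1 hx m
    simp only [hIeq]
    rw [← Finset.mul_sum, Finset.sum_sub_distrib, Finset.sum_sub_distrib, Finset.sum_const,
      Finset.card_univ, Fintype.card_fin, nsmul_eq_mul, ← mul_assoc, mul_comm (n : ℝ)⁻¹, mul_assoc]
    refine mul_le_mul_of_nonneg_left ?_ (hc x)
    rw [← div_eq_inv_mul, le_div_iff₀ hn']
    linarith
  have hInn : 0 ≤ᵐ[ν] fun x => (n : ℝ)⁻¹ * ∑ i, I i x := by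
    filter_upwards [hle] with x hx
    exact (mul_nonneg (hc x) (hm _)).trans hx
  calc _ ≤ ∫⁻ x, ENNReal.ofReal ((n : ℝ)⁻¹ * ∑ i, I i x) ∂ν := by
        refine lintegral_mono_ae ?_
        filter_upwards [hle] with x hx
        exact ENNReal.ofReal_le_ofReal hx
    _ = ENNReal.ofReal (∫ x, (n : ℝ)⁻¹ * ∑ i, I i x ∂ν) :=
        (ofReal_integral_eq_lintegral_ofReal
          ((integrable_finsetSum _ fun i _ => hIi i).const_mul _) hInn).symm
    _ = _ := by
        rw [integral_const_mul, integral_finsetSum _ fun i _ => hIi i]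
        simp only [hIint]

/-- The rate bound on the product space of a sample and an additional observation. -/
theorem lintegral_dist_sq_le (hQ : IsHadamard Q) (hτ : IsTransformation τ) (hn : 0 < n)
    (hint : Integrable (fun y => transDeriv τ (dist y m)) μ)
    (hm : ∀ q, 0 ≤ ∫ y, (τ (dist y q) - τ (dist y m)) ∂μ) (hM : StronglyMeasurable M)
    (hgood : ∀ᵐ x ∂(Measure.pi fun _ : Fin n => μ), IsSampleFrechetMean τ x (M x))
    (hσ : ∀ i, MeasurePreserving (exchange i) ((Measure.pi fun _ : Fin n => μ).prod μ)
      ((Measure.pi fun _ : Fin n => μ).prod μ)) :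
    ∫⁻ z, ENNReal.ofReal (dist m (M z.1) ^ 2) *
        transRightDeriv2 τ (dist z.2 m + dist m (M z.1)) ∂((Measure.pi fun _ : Fin n => μ).prod μ)
      ≤ 32 / (n : ℝ≥0∞) ^ 2 * ∑ i, ∫⁻ z, stabilityIntegrand τ m M i z
          ∂((Measure.pi fun _ : Fin n => μ).prod μ) := by
  set ν := Measure.pi fun _ : Fin n => μ
  have hn' : (0 : ℝ) < n := by exact_mod_cast hn
  have hn0 : (n : ℝ≥0∞) ≠ 0 := by simpa using hn.ne'
  -- Only the finite case has content, and there the exchange costs are integrable.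
  by_cases hfin : ∀ i, ∫⁻ z, stabilityIntegrand τ m M i z ∂(ν.prod μ) ≠ ∞
  swap
  · push Not at hfin
    obtain ⟨i, hi⟩ := hfin
    have : ∑ i, ∫⁻ z, stabilityIntegrand τ m M i z ∂(ν.prod μ) = ∞ :=
      ENNReal.sum_eq_top.2 ⟨i, Finset.mem_univ i, hi⟩
    rw [this, ENNReal.mul_top]
    · exact le_top
    · simp
  have hWle := fun i => lintegral_exchangeCost_le (m := m) hQ hτ hM hgood i (hσ i)
  have hWi : ∀ i, Integrable (exchangeCost τ m M i) (ν.prod μ) := by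
    intro i
    refine ⟨(measurable_exchangeCost hτ hM i).aestronglyMeasurable, ?_⟩
    rw [hasFiniteIntegral_iff_ofReal (ae_of_all _ fun z => exchangeCost_nonneg hτ i z)]
    refine (hWle i).trans_lt (ENNReal.mul_lt_top ?_ (hfin i).lt_top)
    exact ENNReal.div_lt_top (by simp) hn0
  have hDm' : Measurable fun x : Fin n → Q => dist (M x) m := hM.measurable_dist measurable_const
  have hfm := measurable_weighted_dist_sq (m := m) hτ hM
  set L : (Fin n → Q) → ℝ≥0∞ := fun x => ∫⁻ y, ENNReal.ofReal (dist m (M x) ^ 2) *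
    transRightDeriv2 τ (dist y m + dist m (M x)) ∂μ with hL
  have hLm : Measurable L := hfm.lintegral_prod_right'
  have hLle : ∀ x, L x ≤ 2 * ENNReal.ofReal (∫ y, (τ (dist y (M x)) - τ (dist y m)) ∂μ) :=
    fun x => lintegral_transRightDeriv2_le hQ hτ hint hm (M x)
  set κ : ℕ → (Fin n → Q) → ℝ := fun k x => cutoff ((k : ℝ) + 1) (dist (M x) m) with hκ
  have hκm : ∀ k, Measurable (κ k) := fun k => measurable_const.div (measurable_const.add hDm')
  have hκ0 : ∀ k x, 0 ≤ κ k x := fun k x => (cutoff_mem_Icc (by positivity) dist_nonneg).1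
  have hstep : ∀ k, ∫⁻ x, ENNReal.ofReal (κ k x) * L x ∂ν ≤ 2 * ENNReal.ofReal ((n : ℝ)⁻¹ *
      ∑ i, ∫ z, exchangeCost τ m M i z *
        (1 + (1 - cutoff ((k : ℝ) + 1) (dist (M (exchange i z).1) m))) ∂(ν.prod μ)) := by
    intro k
    have hK : (0 : ℝ) < (k : ℝ) + 1 := by positivity
    calc ∫⁻ x, ENNReal.ofReal (κ k x) * L x ∂ν
        ≤ ∫⁻ x, 2 * ENNReal.ofReal (κ k x * ∫ y, (τ (dist y (M x)) - τ (dist y m)) ∂μ) ∂ν := by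
          refine lintegral_mono fun x => ?_
          rw [ENNReal.ofReal_mul (hκ0 k x), mul_left_comm]
          exact mul_le_mul_right (hLle x) _
      _ = 2 * ∫⁻ x, ENNReal.ofReal (κ k x * ∫ y, (τ (dist y (M x)) - τ (dist y m)) ∂μ) ∂ν :=
          lintegral_const_mul' _ _ (by simp)
      _ ≤ _ := by
          gcongr
          refine (lintegral_cutoff_excess_le hQ hτ hn hint hm hM hgood hK).trans ?_
          exact ENNReal.ofReal_le_ofReal (mul_le_mul_of_nonneg_left (Finset.sum_le_sum fun i _ =>
            integral_excessDiff_le hQ hτ hint hM i (hσ i) (hWi i) hK) (by positivity))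
  -- Monotone convergence handles the left side, whose limit may a priori be infinite; dominated
  -- convergence by twice the exchange cost handles the right side.
  have hlim1 : Tendsto (fun k => ∫⁻ x, ENNReal.ofReal (κ k x) * L x ∂ν) atTop
      (𝓝 (∫⁻ x, L x ∂ν)) := by
    refine lintegral_tendsto_of_tendsto_of_monotone
      (fun k => ((hκm k).ennreal_ofReal.mul hLm).aemeasurable) (ae_of_all _ fun x k l hkl => ?_)
      (ae_of_all _ fun x => ?_)
    · have := monotone_cutoff (dist_nonneg (x := M x) (y := m)) hkl
      dsimp only [κ] at this ⊢
      gcongr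
    · have h1 := ENNReal.tendsto_ofReal (tendsto_cutoff (dist (M x) m))
      rw [ENNReal.ofReal_one] at h1
      simpa using ENNReal.Tendsto.mul_const (b := L x) h1 (Or.inl one_ne_zero)
  have hlim2 := ENNReal.Tendsto.const_mul (a := 2) (ENNReal.tendsto_ofReal
    ((tendsto_finsetSum Finset.univ fun i _ =>
      tendsto_integral_exchangeCost hM i (hWi i)).const_mul (n : ℝ)⁻¹)) (Or.inr (by simp))
  have hmain := le_of_tendsto_of_tendsto' hlim1 hlim2 hstep
  rw [lintegral_prod _ hfm.aemeasurable]
  refine hmain.trans ?_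
  rw [ENNReal.ofReal_mul (by positivity), ENNReal.ofReal_inv_of_pos hn', ENNReal.ofReal_natCast,
    ENNReal.ofReal_sum_of_nonneg fun i _ => integral_nonneg fun z => exchangeCost_nonneg hτ i z]
  calc 2 * ((n : ℝ≥0∞)⁻¹ * ∑ i, ENNReal.ofReal (∫ z, exchangeCost τ m M i z ∂(ν.prod μ)))
      ≤ 2 * ((n : ℝ≥0∞)⁻¹ * ∑ i, 16 / n * ∫⁻ z, stabilityIntegrand τ m M i z ∂(ν.prod μ)) := by
        gcongr with i
        rw [ofReal_integral_eq_lintegral_ofReal (hWi i)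
          (ae_of_all _ fun z => exchangeCost_nonneg hτ i z)]
        exact hWle i
    _ = _ := by
        rw [← Finset.mul_sum, ← mul_assoc, ← mul_assoc]
        congr 1
        rw [div_eq_mul_inv, div_eq_mul_inv, ENNReal.inv_pow]
        ring

end Bound

/-! ### Joint laws, the quadratic transformation and degenerate samples. -/

theorem map_prodMk_eq_pi_prod {Ω Q : Type*} [MeasurableSpace Ω] {P : Measure Ω}
    [IsProbabilityMeasure P] [MeasurableSpace Q] {μ : Measure Q} [IsProbabilityMeasure μ] {n : ℕ}
    {f : Option (Fin n) → Ω → Q} (hf : iIndepFun f P) (hmeas : ∀ k, AEMeasurable (f k) P)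
    (hlaw : ∀ k, P.map (f k) = μ) :
    P.map (fun ω => (fun j => f (some j) ω, f none ω)) = (Measure.pi fun _ : Fin n => μ).prod μ := by
  have h1 := (iIndepFun_iff_map_fun_eq_pi_map hmeas).1 hf
  simp only [hlaw] at h1
  have h2 := Measure.pi_map_piOptionEquivProd (β := fun _ : Option (Fin n) => Q) (fun _ => μ)
  set e := MeasurableEquiv.piOptionEquivProd (fun _ : Option (Fin n) => Q)
  have h3 : (P.map (fun ω k => f k ω)).map e = (Measure.pi fun _ : Fin n => μ).prod μ := by
    rw [h1, ← h2, Measure.map_map e.measurable e.symm.measurable]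
    simp
  rw [← h3, AEMeasurable.map_map_of_aemeasurable e.measurable.aemeasurable
    (aemeasurable_pi_lambda _ hmeas)]
  rfl

theorem transDeriv_sq {τ : ℝ → ℝ} (hτ : IsTransformation τ) (h : ∀ x, 0 ≤ x → τ x = x ^ 2) {x : ℝ}
    (hx : 0 ≤ x) : transDeriv τ x = 2 * x := by
  have hpos : ∀ x, 0 < x → transDeriv τ x = 2 * x := by
    intro x hx
    rw [IsTransformation.transDeriv_of_pos hx]
    have : τ =ᶠ[𝓝 x] fun x => x ^ 2 := by
      filter_upwards [Ioi_mem_nhds hx] with y hy using h y (le_of_lt hy)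
    rw [this.deriv_eq]
    simp
  rcases hx.eq_or_lt with rfl | hx
  · refine tendsto_nhds_unique hτ.tendsto_transDeriv_zero ?_
    have h1 : Tendsto (fun x : ℝ => 2 * x) (𝓝[>] 0) (𝓝 (2 * 0)) :=
      ((continuous_const.mul continuous_id).tendsto (0 : ℝ)).mono_left nhdsWithin_le_nhds
    refine h1.congr' ?_
    filter_upwards [self_mem_nhdsWithin] with y hy using (hpos y hy).symm
  · exact hpos x hx

theorem transRightDeriv2_sq {τ : ℝ → ℝ} (hτ : IsTransformation τ)
    (h : ∀ x, 0 ≤ x → τ x = x ^ 2) {x : ℝ} (hx : 0 ≤ x) : transRightDeriv2 τ x = 2 := by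
  have hslope : ∀ y, x < y →
      ENNReal.ofReal ((transDeriv τ y - transDeriv τ x) / (y - x)) = 2 := by
    intro y hy
    have : y - x ≠ 0 := by linarith
    rw [transDeriv_sq hτ h hx, transDeriv_sq hτ h (hx.trans hy.le), ← mul_sub,
      mul_div_cancel_right₀ _ this]
    simp
  rw [hτ.transRightDeriv2_eq_iSup hx]
  refine le_antisymm (iSup₂_le fun y hy => (hslope y hy).le) ?_
  rw [← hslope (x + 1) (by linarith)]
  exact le_iSup₂ (f := fun y (_ : y ∈ Ioi x) =>
    ENNReal.ofReal ((transDeriv τ y - transDeriv τ x) / (y - x))) (x + 1) (by simp)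

/-- The weights cannot all vanish where the derivatives of the loss at `m` all vanish. -/
theorem exists_transDeriv_ne_zero {Q : Type*} [MetricSpace Q] {τ : ℝ → ℝ} {n : ℕ}
    (hτ : IsTransformation τ) (hn : 0 < n) {y : Fin n → Q} {x : Q} (m : Q)
    (hx : IsSampleFrechetMean τ y x) (h0 : ∀ j, transRightDeriv2 τ (dist (y j) x) = 0) :
    ∃ i, transDeriv τ (dist (y i) m) ≠ 0 := by
  by_contra! hcon
  -- If τ' vanishes at every d(y_i,m), all observations equal m and so does the minimizer. Then τ'
  -- and τ'' both vanish at 0, which forces τ' 1 ≤ 0.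
  have hy : ∀ i, y i = m := fun i => by
    by_contra hne
    exact (hτ.transDeriv_pos (dist_pos.2 hne)).ne' (hcon i)
  have ht0 : transDeriv τ 0 = 0 := by simpa [hy] using hcon ⟨0, hn⟩
  have h1 := isSampleFrechetMean_iff.1 hx m
  simp only [hy, dist_self, hτ.zero, Finset.sum_const_zero, Finset.sum_const, Finset.card_univ,
    Fintype.card_fin, nsmul_eq_mul] at h1
  have hxm : dist m x = 0 := by
    by_contra hne
    have := hτ.pos (lt_of_le_of_ne dist_nonneg (Ne.symm hne))
    have hn' : (0 : ℝ) < n := by exact_mod_cast hn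
    nlinarith [mul_pos hn' this]
  have h2 := h0 ⟨0, hn⟩
  rw [hy, hxm] at h2
  have h3 := hτ.slope_le_transRightDeriv2 le_rfl one_pos
  rw [h2, ht0, nonpos_iff_eq_zero, ENNReal.ofReal_eq_zero] at h3
  have := hτ.transDeriv_pos one_pos
  norm_num at h3
  linarith

theorem aemeasurable_dist_of_ae_mem_closure {Ω Q : Type*} [MeasurableSpace Ω] {P : Measure Ω}
    [MetricSpace Q] [MeasurableSpace Q] [BorelSpace Q] {f g : Ω → Q} {s : ℕ → Q}
    (hf : AEMeasurable f P) (hs : ∀ᵐ ω ∂P, f ω ∈ closure (range s)) (hg : AEMeasurable g P) :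
    AEMeasurable (fun ω => dist (f ω) (g ω)) P := by
  have hf' : AEStronglyMeasurable f P := aestronglyMeasurable_iff_aemeasurable_separable.2
    ⟨hf, closure (range s), (countable_range s).isSeparable.closure, hs⟩
  refine ⟨fun ω => dist (hf'.mk f ω) (hg.mk g ω),
    hf'.stronglyMeasurable_mk.measurable_dist hg.measurable_mk, ?_⟩
  filter_upwards [hf'.ae_eq_mk, hg.ae_eq_mk] with ω h1 h2
  rw [h1, h2]

theorem lintegral_eq_top_of_nullMeasurableSet {Ω : Type*} [MeasurableSpace Ω] {P : Measure Ω}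
    {C : Set Ω} (hC : NullMeasurableSet C P) (hP : P C ≠ 0) {g : Ω → ℝ≥0∞}
    (hg : ∀ ω ∈ C, g ω = ∞) : ∫⁻ ω, g ω ∂P = ∞ := by
  refine top_le_iff.1 ?_
  calc ∞ = ∫⁻ _ in C, ∞ ∂P := by simp [ENNReal.top_mul hP]
    _ ≤ ∫⁻ ω in C, g ω ∂P := by
        refine lintegral_mono_ae ?_
        filter_upwards [ae_restrict_mem₀ hC] with ω hω
        rw [hg ω hω]
    _ ≤ ∫⁻ ω, g ω ∂P := setLIntegral_le_lintegral _ _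

/-! ### Transfer to the random variables. -/

section Main

variable {Ω Q : Type*} [MeasurableSpace Ω] {P : Measure Ω} [MetricSpace Q]
  [MeasurableSpace Q] [BorelSpace Q] {τ : ℝ → ℝ} {n : ℕ}

/-- The stability bound is infinite if the sample mean may fail to be unique. -/
theorem exists_lintegral_stability_eq_top (hτ : IsTransformation τ) (hn : 0 < n) {s : ℕ → Q}
    {X : Fin n → Ω → Q} {a : Ω → Q} {b : Fin n → Ω → Q} (m : Q) (hX : ∀ j, AEMeasurable (X j) P)
    (hs : ∀ j, ∀ᵐ ω ∂P, X j ω ∈ closure (range s)) (ha : AEMeasurable a P)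
    (hmin : ∀ᵐ ω ∂P, IsSampleFrechetMean τ (fun j => X j ω) (a ω))
    (hB : P {ω | ∀ j, transRightDeriv2 τ (dist (X j ω) (a ω)) = 0} ≠ 0) :
    ∃ i, ∫⁻ ω, ENNReal.ofReal (transDeriv τ (dist (X i ω) m) ^ 2) *
      (stabilityH τ (fun j => X j ω) (a ω) (b i ω))⁻¹ ∂P = ∞ := by
  set B := {ω | ∀ j, transRightDeriv2 τ (dist (X j ω) (a ω)) = 0} with hBdef
  set A : Fin n → Set Ω := fun i => {ω | transDeriv τ (dist (X i ω) m) ≠ 0} with hA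
  have hBm : NullMeasurableSet B P := by
    rw [hBdef, show {ω | ∀ j, transRightDeriv2 τ (dist (X j ω) (a ω)) = 0}
      = ⋂ j, {ω | transRightDeriv2 τ (dist (X j ω) (a ω)) = 0} by ext; simp]
    refine NullMeasurableSet.iInter fun j => ?_
    have h1 : Measurable fun r : ℝ => transRightDeriv2 τ |r| :=
      hτ.measurable_transRightDeriv2_comp continuous_abs.measurable abs_nonneg
    have h2 := h1.comp_aemeasurable (aemeasurable_dist_of_ae_mem_closure (hX j) (hs j) ha)
    simp only [Function.comp_def, abs_dist] at h2
    exact h2.nullMeasurableSet_preimage (measurableSet_singleton 0)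
  have hAm : ∀ i, NullMeasurableSet (A i) P := fun i =>
    ((measurable_transDeriv_dist hτ m).comp_aemeasurable (hX i)).nullMeasurableSet_preimage
      (measurableSet_singleton (0 : ℝ)).compl
  obtain ⟨i, hi⟩ : ∃ i, P (B ∩ A i) ≠ 0 := by
    by_contra! hcon
    refine hB (measure_mono_null_ae ?_ (measure_iUnion_null hcon))
    filter_upwards [hmin] with ω hω hωB
    obtain ⟨i, hi⟩ := exists_transDeriv_ne_zero hτ hn m hω hωB
    exact mem_iUnion.2 ⟨i, hωB, hi⟩
  refine ⟨i, lintegral_eq_top_of_nullMeasurableSet (hBm.inter (hAm i)) hi ?_⟩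
  rintro ω ⟨hωB, hωA⟩
  -- τ'' is nonincreasing, so it also vanishes at the arguments enlarged by d(a,b), whatever b is.
  have hH : stabilityH τ (fun j => X j ω) (a ω) (b i ω) = 0 := by
    rw [stabilityH, Finset.sum_eq_zero, mul_zero]
    intro j _
    refine le_antisymm ?_ zero_le
    rw [← hωB j]
    exact hτ.antitoneOn_transRightDeriv2 (mem_Ici.2 dist_nonneg) (mem_Ici.2 (by positivity))
      (le_add_of_nonneg_right dist_nonneg)
  have hne : transDeriv τ (dist (X i ω) m) ≠ 0 := hωA
  have hpos : 0 < transDeriv τ (dist (X i ω) m) ^ 2 := by positivity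
  rw [hH, ENNReal.inv_zero, ENNReal.mul_top (ENNReal.ofReal_pos.2 hpos).ne']

/-- The rate bound, with the sample size given as a positive number. -/
theorem lintegral_dist_sq_le_stability [IsProbabilityMeasure P] (hQ : IsHadamard Q) (hτ : IsTransformation τ) (hn : 0 < n)
    {Y : Ω → Q} {Ys Ys' : Fin n → Ω → Q} (hY : Measurable Y)
    (hYsep : ∃ S : Set Q, TopologicalSpace.IsSeparable S ∧ ∀ᵐ ω ∂P, Y ω ∈ S)
    (hYs : ∀ i, IdentDistrib (Ys i) Y P P) (hYs' : ∀ i, IdentDistrib (Ys' i) Y P P)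
    (hindep : iIndepFun
      (fun k : Option (Fin n ⊕ Fin n) => k.elim Y (Sum.elim Ys Ys')) P)
    {o : Q} (hmom : Integrable (fun ω => transDeriv τ (dist (Y ω) o)) P)
    {m : Q} (hm : IsFrechetMean P τ Y o m)
    {mn : Ω → Q} (hmn_meas : AEMeasurable mn P)
    (hmn : ∀ᵐ ω ∂P, IsSampleFrechetMean τ (fun j => Ys j ω) (mn ω))
    {mni : Fin n → Ω → Q}
    (hmni : ∀ i, ∀ᵐ ω ∂P,
      IsSampleFrechetMean τ (Function.update (fun j => Ys j ω) i (Ys' i ω)) (mni i ω)) :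
    ∫⁻ ω, ENNReal.ofReal (dist m (mn ω) ^ 2) *
        transRightDeriv2 τ (dist (Y ω) m + dist m (mn ω)) ∂P
      ≤ 32 / (n : ℝ≥0∞) ^ 2 * ∑ i, ∫⁻ ω, ENNReal.ofReal (transDeriv τ (dist (Ys i ω) m) ^ 2) *
          (stabilityH τ (fun j => Ys j ω) (mn ω) (mni i ω))⁻¹ ∂P := by
  obtain ⟨s, hs⟩ : ∃ s : ℕ → Q, ∀ᵐ ω ∂P, Y ω ∈ closure (range s) := by
    obtain ⟨S, ⟨c, hc, hSc⟩, hYS⟩ := hYsep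
    obtain ⟨ω, hω⟩ := hYS.exists
    obtain ⟨s, rfl⟩ := hc.exists_eq_range (closure_nonempty_iff.1 ⟨_, hSc hω⟩)
    exact ⟨s, hYS.mono fun ω hω => hSc hω⟩
  have hYsm : ∀ j, AEMeasurable (Ys j) P := fun j => (hYs j).aemeasurable_fst
  have hYs'm : ∀ j, AEMeasurable (Ys' j) P := fun j => (hYs' j).aemeasurable_fst
  have hsYs : ∀ j, ∀ᵐ ω ∂P, Ys j ω ∈ closure (range s) := fun j =>
    (hYs j).symm.ae_mem_snd isClosed_closure.measurableSet hs
  -- Outside this null event the sample mean is unique, hence a function of the sample; if the event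
  -- has positive probability, the right-hand side is infinite.
  by_cases hB : P {ω | ∀ j, transRightDeriv2 τ (dist (Ys j ω) (mn ω)) = 0} = 0
  swap
  · obtain ⟨i, hi⟩ := exists_lintegral_stability_eq_top (b := mni) hτ hn m hYsm hsYs hmn_meas
      hmn hB
    rw [ENNReal.sum_eq_top.2 ⟨i, Finset.mem_univ i, hi⟩, ENNReal.mul_top]
    · exact le_top
    · simp
  set μ := P.map Y with hμ
  have hμp : IsProbabilityMeasure μ := Measure.isProbabilityMeasure_map hY.aemeasurable
  have hinto : Integrable (fun y => transDeriv τ (dist y o)) μ :=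
    (integrable_map_measure (measurable_transDeriv_dist hτ o).aestronglyMeasurable
      hY.aemeasurable).2 hmom
  have hint := integrable_transDeriv_dist hτ hinto m
  have hmpos : ∀ q, 0 ≤ ∫ y, (τ (dist y q) - τ (dist y m)) ∂μ := by
    intro q
    have h1 := isMinOn_univ_iff.1 hm q
    have h2 : ∀ q, ∫ ω, (τ (dist (Y ω) q) - τ (dist (Y ω) o)) ∂P
        = ∫ y, (τ (dist y q) - τ (dist y o)) ∂μ := fun q =>
      (integral_map hY.aemeasurable ((measurable_transformation_dist hτ q).sub
        (measurable_transformation_dist hτ o)).aestronglyMeasurable).symm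
    simp only [h2] at h1
    have h3 : ∫ y, (τ (dist y q) - τ (dist y m)) ∂μ = ∫ y, (τ (dist y q) - τ (dist y o)) ∂μ
        - ∫ y, (τ (dist y m) - τ (dist y o)) ∂μ := by
      rw [← integral_sub (integrable_transformation_sub hτ hinto q)
        (integrable_transformation_sub hτ hinto m)]
      simp
    rw [h3]
    linarith
  set ν := Measure.pi fun _ : Fin n => μ with hν
  set F : Option (Fin n ⊕ Fin n) → Ω → Q := fun k => k.elim Y (Sum.elim Ys Ys') with hF
  have hFm : ∀ k, AEMeasurable (F k) P := by
    rintro (_ | i | i)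
    exacts [hY.aemeasurable, hYsm i, hYs'm i]
  have hFlaw : ∀ k, P.map (F k) = μ := by
    rintro (_ | i | i)
    exacts [rfl, (hYs i).map_eq, (hYs' i).map_eq]
  -- Any n + 1 distinct variables of the family have the same joint law. This covers the sample with
  -- Y, the sample with Y_i', and the sample after the exchange.
  have hlaw : ∀ e : Option (Fin n) → Option (Fin n ⊕ Fin n), Function.Injective e →
      P.map (fun ω => (fun j => F (e (some j)) ω, F (e none) ω)) = ν.prod μ := fun e he =>
    map_prodMk_eq_pi_prod (f := fun k => F (e k)) (hindep.precomp he) (fun k => hFm _)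
      fun k => hFlaw _
  set X : Ω → Fin n → Q := fun ω j => Ys j ω with hXdef
  have hXm : AEMeasurable X P := aemeasurable_pi_lambda _ hYsm
  have hlawY : P.map (fun ω => (X ω, Y ω)) = ν.prod μ :=
    hlaw (fun k => k.elim none fun j => some (Sum.inl j)) (by
      rintro (_ | a) (_ | b) h <;> simp_all)
  have hlaw1 : ∀ i, P.map (fun ω => (X ω, Ys' i ω)) = ν.prod μ := fun i =>
    hlaw (fun k => k.elim (some (Sum.inr i)) fun j => some (Sum.inl j)) (by
      rintro (_ | a) (_ | b) h <;> simp_all)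
  have hlaw2 : ∀ i, P.map (fun ω => exchange i (X ω, Ys' i ω)) = ν.prod μ := by
    intro i
    have h1 := hlaw (fun k => k.elim (some (Sum.inl i))
      fun j => if j = i then some (Sum.inr i) else some (Sum.inl j)) (by
        rintro (_ | a) (_ | b) h
        · rfl
        · by_cases hb : b = i <;> simp_all [eq_comm]
        · by_cases ha : a = i <;> simp_all
        · by_cases ha : a = i <;> by_cases hb : b = i <;> simp_all)
    convert! h1 using 2
    funext ω
    refine Prod.ext (funext fun j => ?_) rfl
    by_cases hj : j = i
    · subst hj; simp [exchange, hF]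
    · simp [exchange, hF, hj, hXdef]
  have hσ : ∀ i, MeasurePreserving (exchange i) (ν.prod μ) (ν.prod μ) := fun i =>
    ⟨measurable_exchange i, by
      conv_lhs => rw [← hlaw1 i]
      rw [AEMeasurable.map_map_of_aemeasurable (measurable_exchange i).aemeasurable
        (hXm.prodMk (hYs'm i))]
      exact hlaw2 i⟩
  obtain ⟨M, hM, G, hG, hGmin, hGsel⟩ :=
    exists_stronglyMeasurable_sampleFrechetMean hQ hτ n s
  -- A measurable set of samples on which M is the unique minimizer, so membership can be
  -- transported between laws.
  set G' := G ∩ {x | ∃ j, transRightDeriv2 τ (dist (x j) (M x)) ≠ 0} with hG'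
  have hG'm : MeasurableSet G' := by
    refine hG.inter ?_
    rw [show {x : Fin n → Q | ∃ j, transRightDeriv2 τ (dist (x j) (M x)) ≠ 0}
      = ⋃ j, {x | transRightDeriv2 τ (dist (M x) (x j)) ≠ 0} by ext; simp [dist_comm]]
    refine MeasurableSet.iUnion fun j => ?_
    exact hτ.measurable_transRightDeriv2_comp (hM.measurable_dist (measurable_pi_apply j))
      (fun _ => dist_nonneg) (measurableSet_singleton 0).compl
  have hXG : ∀ᵐ ω ∂P, X ω ∈ G' ∧ M (X ω) = mn ω := by
    filter_upwards [ae_all_iff.2 hsYs, hmn, measure_eq_zero_iff_ae_notMem.1 hB] with ω h1 h2 h3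
    have h3' : ∃ j, transRightDeriv2 τ (dist (Ys j ω) (mn ω)) ≠ 0 := by
      simpa using h3
    obtain ⟨h4, h5⟩ := hGsel (X ω) h1 (mn ω) h2 h3'
    exact ⟨⟨h4, by rw [mem_ofPred_eq, h5]; exact h3'⟩, h5⟩
  have hνG : ∀ᵐ x ∂ν, x ∈ G' := by
    have h1 : P.map X = ν := by
      rw [← (measurePreserving_fst (μ := ν) (ν := μ)).map_eq, ← hlawY,
        AEMeasurable.map_map_of_aemeasurable measurable_fst.aemeasurable
          (hXm.prodMk hY.aemeasurable)]
      rfl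
    rw [← h1]
    exact (ae_map_iff hXm (p := fun x => x ∈ G') hG'm).2 (hXG.mono fun ω hω => hω.1)
  have hgood : ∀ᵐ x ∂ν, IsSampleFrechetMean τ x (M x) := hνG.mono fun x hx => hGmin x hx.1
  -- The exchanged sample has the law of the original one, so its minimizer is almost surely unique
  -- too and equals the given one.
  have hXiG : ∀ i, ∀ᵐ ω ∂P, M (exchange i (X ω, Ys' i ω)).1 = mni i ω := by
    intro i
    have h1 : ∀ᵐ z ∂(ν.prod μ), (exchange i z).1 ∈ G' :=
      (hσ i).quasiMeasurePreserving.ae (Measure.quasiMeasurePreserving_fst.ae hνG)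
    rw [← hlaw1 i] at h1
    filter_upwards [ae_of_ae_map (hXm.prodMk (hYs'm i)) h1, hmni i] with ω h2 h3
    exact ((hGmin _ h2.1).eq_of_ne_zero hQ hτ h2.2 h3).symm
  have hmain := lintegral_dist_sq_le hQ hτ hn hint hmpos hM hgood hσ
  calc ∫⁻ ω, ENNReal.ofReal (dist m (mn ω) ^ 2) *
        transRightDeriv2 τ (dist (Y ω) m + dist m (mn ω)) ∂P
      = ∫⁻ ω, ENNReal.ofReal (dist m (M (X ω)) ^ 2) *
        transRightDeriv2 τ (dist (Y ω) m + dist m (M (X ω))) ∂P := by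
        refine lintegral_congr_ae ?_
        filter_upwards [hXG] with ω hω
        rw [hω.2]
    _ = ∫⁻ z, ENNReal.ofReal (dist m (M z.1) ^ 2) *
        transRightDeriv2 τ (dist z.2 m + dist m (M z.1)) ∂(ν.prod μ) := by
        rw [← hlawY, lintegral_map' (measurable_weighted_dist_sq hτ hM).aemeasurable
          (hXm.prodMk hY.aemeasurable)]
    _ ≤ _ := hmain
    _ = _ := by
        congr 1
        refine Finset.sum_congr rfl fun i _ => ?_
        rw [← hlaw1 i, lintegral_map' (measurable_stabilityIntegrand hτ hM i).aemeasurable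
          (hXm.prodMk (hYs'm i))]
        refine lintegral_congr_ae ?_
        filter_upwards [hXG, hXiG i] with ω h1 h2
        rw [stabilityIntegrand, h2, h1.2]

end Main

theorem mainTheorem12 {Ω Q : Type*} [MeasurableSpace Ω] (P : Measure Ω) [IsProbabilityMeasure P]
    [MetricSpace Q] [MeasurableSpace Q] [BorelSpace Q] (hQ : IsHadamard Q)
    (τ : ℝ → ℝ) (hτ : IsTransformation τ)
    (n : ℕ) (hn : 1 ≤ n)
    -- the random variable, the sample, and the independent second sample
    (Y : Ω → Q) (Ys Ys' : Fin n → Ω → Q)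
    (hY : Measurable Y)
    (hYsep : ∃ S : Set Q, TopologicalSpace.IsSeparable S ∧ ∀ᵐ ω ∂P, Y ω ∈ S)
    (hYs : ∀ i, IdentDistrib (Ys i) Y P P) (hYs' : ∀ i, IdentDistrib (Ys' i) Y P P)
    (hindep : iIndepFun
      (fun k : Option (Fin n ⊕ Fin n) => k.elim Y (Sum.elim Ys Ys')) P)
    -- moment condition
    (o : Q) (hmom : Integrable (fun ω => transDeriv τ (dist (Y ω) o)) P)
    -- population mean, sample mean, sample means after replacing the `i`-th observation
    (m : Q) (hm : IsFrechetMean P τ Y o m)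
    (mn : Ω → Q) (hmn_meas : AEMeasurable mn P)
    (hmn : ∀ᵐ ω ∂P, IsSampleFrechetMean τ (fun j => Ys j ω) (mn ω))
    (mni : Fin n → Ω → Q) (hmni_meas : ∀ i, AEMeasurable (mni i) P)
    (hmni : ∀ i, ∀ᵐ ω ∂P,
      IsSampleFrechetMean τ (Function.update (fun j => Ys j ω) i (Ys' i ω)) (mni i ω)) :
    (∫⁻ ω, ENNReal.ofReal (dist m (mn ω) ^ 2) *
        transRightDeriv2 τ (dist (Y ω) m + dist m (mn ω)) ∂P
      ≤ 32 / (n : ℝ≥0∞) ^ 2 * ∑ i, ∫⁻ ω, ENNReal.ofReal (transDeriv τ (dist (Ys i ω) m) ^ 2) *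
          (stabilityH τ (fun j => Ys j ω) (mn ω) (mni i ω))⁻¹ ∂P) ∧
    ((∀ x, 0 ≤ x → τ x = x ^ 2) →
      ∫⁻ ω, ENNReal.ofReal (dist m (mn ω) ^ 2) ∂P
        ≤ 32 / (n : ℝ≥0∞) * ∫⁻ ω, ENNReal.ofReal (dist (Y ω) m ^ 2) ∂P) := by
  have hbound := lintegral_dist_sq_le_stability hQ hτ hn hY hYsep hYs hYs' hindep hmom hm
    hmn_meas hmn hmni
  refine ⟨hbound, fun hsq => ?_⟩
  have hn0 : (n : ℝ≥0∞) ≠ 0 := by simp; omega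
  have hH : ∀ ω i, stabilityH τ (fun j => Ys j ω) (mn ω) (mni i ω) = 2 := by
    intro ω i
    rw [stabilityH, Finset.sum_congr rfl fun j _ =>
      transRightDeriv2_sq hτ hsq (add_nonneg (dist_nonneg (x := Ys j ω) (y := mn ω)) dist_nonneg)]
    rw [Finset.sum_const, Finset.card_univ, Fintype.card_fin, nsmul_eq_mul, ← mul_assoc,
      ENNReal.inv_mul_cancel hn0 (by simp), one_mul]
  have hL : ∫⁻ ω, ENNReal.ofReal (dist m (mn ω) ^ 2) *
      transRightDeriv2 τ (dist (Y ω) m + dist m (mn ω)) ∂P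
      = 2 * ∫⁻ ω, ENNReal.ofReal (dist m (mn ω) ^ 2) ∂P := by
    rw [← lintegral_const_mul' _ _ (by simp)]
    refine lintegral_congr fun ω => ?_
    rw [transRightDeriv2_sq hτ hsq (by positivity), mul_comm]
  have hR : ∀ i, ∫⁻ ω, ENNReal.ofReal (transDeriv τ (dist (Ys i ω) m) ^ 2) *
      (stabilityH τ (fun j => Ys j ω) (mn ω) (mni i ω))⁻¹ ∂P
      = 2 * ∫⁻ ω, ENNReal.ofReal (dist (Y ω) m ^ 2) ∂P := by
    intro i
    have hmeas : Measurable fun q : Q => ENNReal.ofReal (dist q m ^ 2) :=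
      ((continuous_id.dist continuous_const).pow 2).measurable.ennreal_ofReal
    have hid := ((hYs i).comp hmeas).lintegral_eq
    simp only [Function.comp_def] at hid
    rw [← hid, ← lintegral_const_mul' _ _ (by simp)]
    refine lintegral_congr fun ω => ?_
    rw [hH, transDeriv_sq hτ hsq dist_nonneg, mul_pow, ENNReal.ofReal_mul (by positivity),
      mul_right_comm]
    congr 1
    rw [show (2 : ℝ) ^ 2 = 2 * 2 by norm_num, ENNReal.ofReal_mul zero_le_two,
      ENNReal.ofReal_ofNat, mul_assoc, ENNReal.mul_inv_cancel (by simp) (by simp), mul_one]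
  rw [hL, Finset.sum_congr rfl fun i _ => hR i, Finset.sum_const, Finset.card_univ,
    Fintype.card_fin, nsmul_eq_mul] at hbound
  -- For τ = x² the weight τ'' = 2 puts a factor 2 on the left, and τ'²/H = 4d²/2 puts a factor 2 in
  -- each summand on the right; these cancel.
  refine (ENNReal.mul_le_mul_iff_right (two_ne_zero) (by simp)).1 (hbound.trans (le_of_eq ?_))
  rw [div_eq_mul_inv, div_eq_mul_inv, ENNReal.inv_pow, sq]
  calc 32 * ((n : ℝ≥0∞)⁻¹ * (n : ℝ≥0∞)⁻¹) *
        (n * (2 * ∫⁻ ω, ENNReal.ofReal (dist (Y ω) m ^ 2) ∂P))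
      = ((n : ℝ≥0∞)⁻¹ * n) * (2 * (32 * (n : ℝ≥0∞)⁻¹ *
        ∫⁻ ω, ENNReal.ofReal (dist (Y ω) m ^ 2) ∂P)) := by ring
    _ = _ := by rw [ENNReal.inv_mul_cancel hn0 (by simp), one_mul]
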